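/- For relatively prime integers $a>b\ge 1$, an $\frac ab$-power is a word $v^{a/b}=v^{\lfloor a/b\rfloor}v'$, where $v$ is a nonempty finite word whose length is divisible by $b$ and $v'$ is the prefix of $v$ of length $|v|\cdot(\frac ab-\lfloor \frac ab\rfloor)$. Let $\mathbf w_{a/b}$ be the lexicographically least infinite word on the alphabet $\mathbb Z_{\ge 0}$ none of whose (contiguous) factors is an $\frac ab$-power. A morphism $\varphi:\mathbb Z_{\ge0}\to\mathbb Z_{\ge0}^*$, extended to words by concatenation, is $k$-uniform if $|\varphi(n)|=k$ for all $n$; if $\varphi(0)$ begins with $0$ and the lengths $|\varphi^n(0)|$ are unbounded, $\varphi^\infty(0)$ denotes the infinite word that has every $\varphi^n(0)$ as a prefix. A $k$-uniform morphism $\varphi$ locates words of length $\ell$ if for each word $x$ of length $\ell$ on $\mathbb Z_{\ge0}$ there is an integer $j$ such that, for every finite word $w$ on $\mathbb Z_{\ge0}$, every occurrence of $x$ in $\varphi(w)$ begins at a position congruent to $j$ modulo $k$. **Theorem.** For each of the following 24 tuples $(\frac ab; d, k, \ell)$ there is a word $u$ of length $k-1$ on $\mathbb Z_{\ge0}$ such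 that the $k$-uniform morphism $\varphi(n)=u\,(n+d)$ satisfies $\mathbf w_{a/b}=\varphi^\infty(0)$; moreover, $\varphi$ locates words of length $\ell$: $(\frac{7}{4};2,50847,12940)$, $(\frac{8}{5};2,733,301)$, $(\frac{13}{9};1,45430,11400)$, $(\frac{17}{10};2,55657,37104)$, $(\frac{15}{11};1,6168,711)$, $(\frac{16}{13};1,12945,1321)$, $(\frac{18}{13};1,4188,2094)$, $(\frac{19}{13};1,7698,946)$, $(\frac{21}{16};2,25441,5606)$, $(\frac{25}{17};1,11705,3268)$, $(\frac{31}{22};1,1645,1160)$, $(\frac{33}{23};1,24995,3576)$, $(\frac{37}{26};1,2359,1680)$, $(\frac{37}{28};1,5349,3861)$, $(\frac{41}{28};1,2103,999)$, $(\frac{49}{34};1,4171,3008)$, $(\frac{55}{38};1,5269,3816)$, $(\frac{53}{40};1,9933,4149)$, $(\frac{59}{42};1,5861,4332)$, $(\frac{65}{46};1,7151,5292)$, $(\frac{67}{46};1,7849,5720)$, $(\frac{71}{50};1,8569,6348)$, $(\frac{73}{50};1,9331,6816)$, $(\frac{77}{54};1,10115,7500)$. Moreover, for $\frac ab=\frac85$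 one may take for $u$ the following word of length $732$ (the concatenation of the lines): $$\begin{aligned} &\texttt{0000000100100000100100000001001100000001001000001001000000010020000} \\ &\texttt{0100100100000001001000001001000001001000000010010010000000100100000} \\ &\texttt{1001000001001000000010010010000000100100000100100000100100000001001} \\ &\texttt{0010000000100100000100100000100100000001001001000000010010000010010} \\ &\texttt{0000100100000001001001000000010010000010010000010010000000100100100} \\ &\texttt{0000010010000010010000010010000000100100100000001001000001001000001} \\ &\texttt{0010110000000100100000100100000001002000001001001000000010010000010} \\ &\texttt{0100000100100000001001001000000010010000010010000010010000000100100} \\ &\texttt{1000000010010000010010000010010000000100100100000001001000001001000} \\ &\texttt{0010010001000100010001000100010001101000000010010000010010000000101} \\ &\texttt{00010001000100010001000100010100000001001000001001000000010100} \end{aligned}$$ and for $\frac ab=\frac74$ one may take for $u$ a word that begins with $000000100100000010010000001001000011$ and ends with $1000000100100000010$. -/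

import Mathlib

/-- A morphism on the alphabet `α`: each letter is sent to a finite word. -/
abbrev WordMorphism (α : Type*) := α → List α

/-- The extension of a morphism to finite words, by concatenation. -/
def WordMorphism.onWord {α : Type*} (φ : WordMorphism α) (w : List α) : List α :=
  w.flatMap φ

/-- `φ` is `k`-uniform. -/
def WordMorphism.IsUniform {α : Type*} (φ : WordMorphism α) (k : ℕ) : Prop :=
  ∀ c, (φ c).length = k

/-- The factor of length `n` of the infinite word `w` that begins at position `i`. -/
def wordFactor {α : Type*} (w : ℕ → α) (i n : ℕ) : List α :=
  (List.range n).map fun j => w (i + j)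

/-- `w = φ^∞(c)`: the letter `c` is the first letter of `φ(c)`, the words `φ^n(c)` become
arbitrarily long, and each of them is a prefix of the infinite word `w`. -/
def WordMorphism.IsIterationLimit {α : Type*} (φ : WordMorphism α) (c : α) (w : ℕ → α) : Prop :=
  (φ c).head? = some c ∧
  (∀ m : ℕ, ∃ n : ℕ, m ≤ (φ.onWord^[n] [c]).length) ∧
  ∀ n : ℕ, φ.onWord^[n] [c] = wordFactor w 0 (φ.onWord^[n] [c]).length

/-- `φ` (a `k`-uniform morphism) locates words of length `ℓ`: for each word `x` of length `ℓ`
there is an integer `j` such that in every image `φ(w)` of a finite word, every occurrence of `x`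
begins at a position congruent to `j` modulo `k`. -/
def WordMorphism.Locates {α : Type*} (φ : WordMorphism α) (k ℓ : ℕ) : Prop :=
  ∀ x : List α, x.length = ℓ → ∃ j : ℤ, ∀ w p s : List α,
    φ.onWord w = p ++ x ++ s → (p.length : ℤ) ≡ j [ZMOD k]

/-- For coprime `a`, `b`: the word `z` is an `a/b`-power, that is `z = v^(a/b)` for a nonempty word
`v` of length divisible by `b`. Here `v^(a/b)` is `⌊a/b⌋` copies of `v` followed by the prefix of `v`
of length `|v|` times the fractional part of `a/b`. -/
def IsFracPower {α : Type*} (a b : ℕ) (z : List α) : Prop :=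
  ∃ v : List α, v ≠ [] ∧ b ∣ v.length ∧
    z = (List.replicate (a / b) v).flatten ++ v.take (v.length / b * (a % b))

/-- The infinite word `w` is `a/b`-power-free: none of its factors is an `a/b`-power. -/
def IsFracPowerFree {α : Type*} (a b : ℕ) (w : ℕ → α) : Prop :=
  ∀ i n : ℕ, ¬ IsFracPower a b (wordFactor w i n)

/-- `w` is the lexicographically least infinite word on the nonnegative integers that avoids
`a/b`-powers. -/
def IsLexLeastFracPowerFree (a b : ℕ) (w : ℕ → ℕ) : Prop :=
  IsLeast {v : Lex (ℕ → ℕ) | IsFracPowerFree a b (ofLex v)} (toLex w)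

/-- The morphism `φ(n) = u (n + d)` on the nonnegative integers. -/
def appendMorphism (u : List ℕ) (d : ℕ) : WordMorphism ℕ :=
  fun n => u ++ [n + d]

/-- The morphism `φ(n) = u (n + d)` is `k`-uniform, the lexicographically least `a/b`-power-free
word is `φ^∞(0)`, and `φ` locates words of length `ℓ`. -/
def Describes (a b d k ℓ : ℕ) (u : List ℕ) : Prop :=
  (appendMorphism u d).IsUniform k ∧
  (∃ w : ℕ → ℕ, IsLexLeastFracPowerFree a b w ∧ (appendMorphism u d).IsIterationLimit 0 w) ∧
  (appendMorphism u d).Locates k ℓ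

/-- The table of the tuples `(a, b, d, k, ℓ)`. -/
def sporadicTable : List (ℕ × ℕ × ℕ × ℕ × ℕ) :=
  [
   (7, 4, 2, 50847, 12940),
   (8, 5, 2, 733, 301),
   (13, 9, 1, 45430, 11400),
   (17, 10, 2, 55657, 37104),
   (15, 11, 1, 6168, 711),
   (16, 13, 1, 12945, 1321),
   (18, 13, 1, 4188, 2094),
   (19, 13, 1, 7698, 946),
   (21, 16, 2, 25441, 5606),
   (25, 17, 1, 11705, 3268),
   (31, 22, 1, 1645, 1160),
   (33, 23, 1, 24995, 3576),
   (37, 26, 1, 2359, 1680),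
   (37, 28, 1, 5349, 3861),
   (41, 28, 1, 2103, 999),
   (49, 34, 1, 4171, 3008),
   (55, 38, 1, 5269, 3816),
   (53, 40, 1, 9933, 4149),
   (59, 42, 1, 5861, 4332),
   (65, 46, 1, 7151, 5292),
   (67, 46, 1, 7849, 5720),
   (71, 50, 1, 8569, 6348),
   (73, 50, 1, 9331, 6816),
   (77, 54, 1, 10115, 7500)]

/-- The word of the `len` decimal digits of `N`, padded with zeros on the left. -/
def digitWord (len N : ℕ) : List ℕ :=
  (List.range len).map fun i => N / 10 ^ (len - 1 - i) % 10

/-- The word `u` of length `732` for `a/b = 8/5`. -/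
def word85 : List ℕ :=
  digitWord 67 0000000100100000100100000001001100000001001000001001000000010020000 ++
  digitWord 67 0100100100000001001000001001000001001000000010010010000000100100000 ++
  digitWord 67 1001000001001000000010010010000000100100000100100000100100000001001 ++
  digitWord 67 0010000000100100000100100000100100000001001001000000010010000010010 ++
  digitWord 67 0000100100000001001001000000010010000010010000010010000000100100100 ++
  digitWord 67 0000010010000010010000010010000000100100100000001001000001001000001 ++
  digitWord 67 0010110000000100100000100100000001002000001001001000000010010000010 ++
  digitWord 67 0100000100100000001001001000000010010000010010000010010000000100100 ++
  digitWord 67 1000000010010000010010000010010000000100100100000001001000001001000 ++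
  digitWord 67 0010010001000100010001000100010001101000000010010000010010000000101 ++
  digitWord 62 00010001000100010001000100010100000001001000001001000000010100

/-- The first `36` letters of the word `u` for `a/b = 7/4`. -/
def word74Prefix : List ℕ :=
  digitWord 36 000000100100000010010000001001000011

/-- The last `19` letters of the word `u` for `a/b = 7/4`. -/
def word74Suffix : List ℕ :=
  digitWord 19 1000000100100000010

/-! Cut the fixed point `w` of `φ(n) = u (n + d)` into blocks of length `k`. The last letters of the
blocks spell `w` raised by `d`; all other letters are those of `u`. Since `1 < a/b < 2`, an
`a/b`-power with parameter `m` is a factor whose first `(a - b) * m` letters, its overlap, recur at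
distance `b * m`. By `describes_of_compat` three finite properties of `u` suffice.

Location: two windows of length `ℓ` at different residues modulo `k` disagree somewhere, whatever
letters `≥ d` stand at the ends of blocks.

Freeness: powers with overlap shorter than `ℓ` are excluded directly. A longer overlap forces `k ∣ b
* m` by location, hence `k ∣ m` by coprimality, and the block ends then spell a power with parameter
`m / k`; this descent is `isFracPowerFree_blockWord`.

Minimality: lowering any letter of `w` completes a power. For letters of `u`, and for letters `< d`
after `u`, this happens inside one block; for letters `≥ d` after `u` the power is the image of an
earlier one (`closesPower_blockWord`). A smaller power-free word would contain such a power at its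
first difference from `w` (`isLexLeast_of_closesPower`).

The finite properties are computed. Sets of positions are binary numbers, so one bitwise operation
treats all positions at once. For location, every window of length `ℓ` contains one of a few sample
blocks, and only shifts that survive some sample block need the full test (`locating_sound`). -/

/-! ### Factors of infinite words and fractional powers -/

theorem getElem?_wordFactor {α : Type*} (w : ℕ → α) (i n j : ℕ) :
    (wordFactor w i n)[j]? = if j < n then some (w (i + j)) else none := by
  unfold wordFactor
  split_ifs with h <;> simp [h]

@[simp]
theorem length_wordFactor {α : Type*} (w : ℕ → α) (i n : ℕ) : (wordFactor w i n).length = n := by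
  simp [wordFactor]

theorem wordFactor_zero_add {α : Type*} (w : ℕ → α) (m n : ℕ) :
    wordFactor w 0 (m + n) = wordFactor w 0 m ++ wordFactor w m n := by
  simp [wordFactor, List.range_add, Function.comp_def]

/-- If `1 < a/b < 2`, an `a/b`-power is a word of length `a * m` with period `b * m`. -/
theorem isFracPower_wordFactor_iff {α : Type*} {a b : ℕ} (hba : b < a) (hab : a < 2 * b)
    (w : ℕ → α) (i n : ℕ) :
    IsFracPower a b (wordFactor w i n) ↔
      ∃ m, 1 ≤ m ∧ n = a * m ∧ ∀ j < (a - b) * m, w (i + j) = w (i + j + b * m) := by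
  have hb : 0 < b := by omega
  have hdiv : a / b = 1 := Nat.div_eq_of_lt_le (by omega) (by omega)
  have hmod : a % b = a - b := by
    rw [Nat.mod_eq_sub_mod hba.le, Nat.mod_eq_of_lt (by omega)]
  have hsplit : ∀ m, a * m = b * m + (a - b) * m := fun m => by
    rw [← add_mul]; congr 1; omega
  have hle : ∀ m, (a - b) * m ≤ b * m := fun m => Nat.mul_le_mul_right m (by omega)
  unfold IsFracPower
  rw [hdiv, hmod]
  simp only [List.replicate_one, List.flatten_singleton]
  constructor
  · rintro ⟨v, hv, ⟨m, hm⟩, hz⟩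
    rw [hm, Nat.mul_div_cancel_left m hb, mul_comm m] at hz
    have hlen := congrArg List.length hz
    simp only [length_wordFactor, List.length_append, List.length_take, hm,
      min_eq_left (hle m)] at hlen
    have hm1 : 1 ≤ m := by
      rcases Nat.eq_zero_or_pos m with rfl | h
      · exact absurd (List.length_eq_zero_iff.1 (by simpa using hm)) hv
      · exact h
    refine ⟨m, hm1, by rw [hsplit, hlen], fun j hj => ?_⟩
    have hjb : j < b * m := hj.trans_le (hle m)
    have h1 := getElem?_wordFactor w i n j
    have h2 := getElem?_wordFactor w i n (j + b * m)
    rw [hz, if_pos (by omega), List.getElem?_append_left (by omega)] at h1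
    rw [hz, if_pos (by omega), List.getElem?_append_right (by omega), hm, Nat.add_sub_cancel,
      List.getElem?_take_of_lt hj, h1, ← add_assoc] at h2
    exact Option.some.inj h2
  · rintro ⟨m, hm1, rfl, h⟩
    refine ⟨wordFactor w i (b * m), ?_, ⟨m, by simp⟩, ?_⟩
    · intro h0
      have := congrArg List.length h0
      simp only [length_wordFactor, List.length_nil] at this
      have := Nat.mul_pos hb hm1
      omega
    · rw [length_wordFactor, Nat.mul_div_cancel_left m hb, mul_comm m]
      apply List.ext_getElem?
      intro j
      rw [getElem?_wordFactor, List.getElem?_append]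
      simp only [length_wordFactor, List.getElem?_take, getElem?_wordFactor]
      have h1 := hsplit m
      have h2 := hle m
      by_cases hj : j < b * m
      · rw [if_pos (by omega), if_pos hj, if_pos hj]
      · rw [if_neg hj]
        by_cases hj' : j - b * m < (a - b) * m
        · rw [if_pos (by omega), if_pos hj', if_pos (by omega), h _ hj']
          congr 2; omega
        · rw [if_neg (by omega), if_neg hj']

/-! ### The fixed point of the morphism -/

/-- The infinite word whose blocks of length `k` consist of the first `k - 1` letters of `U`
followed by the letters of the word itself, increased by `d`. -/
def blockWord (U : ℕ → ℕ) (k d : ℕ) (n : ℕ) : ℕ :=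
  if _h : n % k + 1 = k ∧ 2 ≤ k then blockWord U k d (n / k) + d else U (n % k)
termination_by n
decreasing_by
  -- At `n = 0` the recursive branch would force `k = 1`, against the guard `2 ≤ k`.
  rcases Nat.eq_zero_or_pos n with rfl | hn
  · simp only [Nat.zero_mod] at _h; omega
  · exact Nat.div_lt_self hn _h.2

section blockWord

variable {U : ℕ → ℕ} {k d : ℕ}

theorem blockWord_of_mod_ne {n : ℕ} (h : n % k + 1 ≠ k) : blockWord U k d n = U (n % k) := by
  rw [blockWord, dif_neg (by tauto)]

theorem blockWord_of_mod_eq (hk : 2 ≤ k) {n : ℕ} (h : n % k + 1 = k) :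
    blockWord U k d n = blockWord U k d (n / k) + d := by
  rw [blockWord, dif_pos ⟨h, hk⟩]

theorem mod_add_mul_of_lt (q : ℕ) {r : ℕ} (hr : r < k) : (k * q + r) % k = r := by
  rw [Nat.mul_add_mod, Nat.mod_eq_of_lt hr]

theorem div_add_mul_of_lt (q : ℕ) {r : ℕ} (hr : r < k) : (k * q + r) / k = q := by
  rw [Nat.mul_add_div (by omega), Nat.div_eq_of_lt hr, add_zero]

theorem blockWord_inner (q : ℕ) {r : ℕ} (hr : r + 1 < k) :
    blockWord U k d (k * q + r) = U r := by
  rw [blockWord_of_mod_ne] <;> rw [mod_add_mul_of_lt q (by omega)]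
  omega

theorem blockWord_last (hk : 2 ≤ k) (q : ℕ) :
    blockWord U k d (k * q + (k - 1)) = blockWord U k d q + d := by
  rw [blockWord_of_mod_eq hk] <;> simp only [mod_add_mul_of_lt q (show k - 1 < k by omega),
    div_add_mul_of_lt q (show k - 1 < k by omega)]
  omega

end blockWord

/-! ### Compatible positions, iteration limit and location -/

/-- The letter `e` can occur at position `p` of an image under the morphism `n ↦ u (n + d)`, where
`u` is the word of the first `k - 1` letters of `U`. -/
def FitsAt (U : ℕ → ℕ) (k d p e : ℕ) : Prop :=
  if p % k + 1 = k then d ≤ e else e = U (p % k)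

/-- Some letter can occur at position `p` and at position `q`. -/
def Compat (U : ℕ → ℕ) (k d p q : ℕ) : Prop :=
  ∃ e, FitsAt U k d p e ∧ FitsAt U k d q e

theorem Compat.symm {U : ℕ → ℕ} {k d p q : ℕ} (h : Compat U k d p q) : Compat U k d q p :=
  let ⟨e, h1, h2⟩ := h
  ⟨e, h2, h1⟩

theorem compat_congr {U : ℕ → ℕ} {k d p q p' q' : ℕ} (hp : p % k = p' % k) (hq : q % k = q' % k) :
    Compat U k d p q ↔ Compat U k d p' q' := by
  simp only [Compat, FitsAt, hp, hq]

theorem fitsAt_blockWord {U : ℕ → ℕ} {k d : ℕ} (hk : 2 ≤ k) (n : ℕ) :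
    FitsAt U k d n (blockWord U k d n) := by
  unfold FitsAt
  split_ifs with h
  · rw [blockWord_of_mod_eq hk h]; omega
  · exact blockWord_of_mod_ne h

theorem fitsAt_onWord {U : ℕ → ℕ} {k d : ℕ} (hk : 2 ≤ k) (w : List ℕ) (p e : ℕ)
    (h : ((appendMorphism (wordFactor U 0 (k - 1)) d).onWord w)[p]? = some e) :
    FitsAt U k d p e := by
  induction w generalizing p with
  | nil => simp [WordMorphism.onWord] at h
  | cons c w ih =>
    have hcons : (appendMorphism (wordFactor U 0 (k - 1)) d).onWord (c :: w) =
        (wordFactor U 0 (k - 1) ++ [c + d]) ++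
          (appendMorphism (wordFactor U 0 (k - 1)) d).onWord w := rfl
    have hlen : (wordFactor U 0 (k - 1) ++ [c + d]).length = k := by
      simp; omega
    rw [hcons, List.getElem?_append, hlen] at h
    split_ifs at h with hp
    · unfold FitsAt
      rw [Nat.mod_eq_of_lt hp]
      rw [List.getElem?_append, length_wordFactor, getElem?_wordFactor] at h
      split_ifs at h ⊢ with h1 h2 h2
      · omega
      · have : p - (k - 1) = 0 := by omega
        simp only [this, List.getElem?_cons_zero, Option.some.injEq] at h
        omega
      · simpa using h.symm
      · omega
    · have := ih _ h
      unfold FitsAt at this ⊢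
      rwa [← Nat.mod_eq_sub_mod (by omega)] at this

theorem onWord_wordFactor_blockWord {U : ℕ → ℕ} {k d : ℕ} (hk : 2 ≤ k) (N : ℕ) :
    (appendMorphism (wordFactor U 0 (k - 1)) d).onWord (wordFactor (blockWord U k d) 0 N) =
      wordFactor (blockWord U k d) 0 (k * N) := by
  induction N with
  | zero => rfl
  | succ N ih =>
    have hblock : wordFactor (blockWord U k d) (k * N) k =
        wordFactor U 0 (k - 1) ++ [blockWord U k d N + d] := by
      apply List.ext_getElem?
      intro j
      rw [getElem?_wordFactor, List.getElem?_append, length_wordFactor, getElem?_wordFactor]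
      split_ifs with h1 h2 h2
      · rw [blockWord_inner N (by omega), zero_add]
      · obtain rfl : j = k - 1 := by omega
        simp [blockWord_last hk]
      · omega
      · rw [List.getElem?_eq_none]; simp; omega
    have hone : wordFactor (blockWord U k d) N 1 = [blockWord U k d N] := rfl
    rw [wordFactor_zero_add _ N 1, hone, Nat.mul_add_one, wordFactor_zero_add _ (k * N) k, hblock,
      ← ih]
    simp [WordMorphism.onWord, appendMorphism]

theorem isIterationLimit_blockWord {U : ℕ → ℕ} {k d : ℕ} (hk : 2 ≤ k) (hU : U 0 = 0) :
    (appendMorphism (wordFactor U 0 (k - 1)) d).IsIterationLimit 0 (blockWord U k d) := by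
  have h0 : blockWord U k d 0 = 0 := by
    rw [blockWord_of_mod_ne] <;> simp only [Nat.zero_mod]
    · exact hU
    · omega
  have hiter : ∀ n, (appendMorphism (wordFactor U 0 (k - 1)) d).onWord^[n] [0] =
      wordFactor (blockWord U k d) 0 (k ^ n) := fun n => by
    induction n with
    | zero => simp [wordFactor, h0]
    | succ n ih =>
      rw [Function.iterate_succ_apply', ih, onWord_wordFactor_blockWord hk, pow_succ']
  refine ⟨?_, fun m => ⟨m, ?_⟩, fun n => ?_⟩
  · obtain ⟨k, rfl⟩ := Nat.exists_eq_add_of_le hk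
    rw [appendMorphism, List.head?_append, List.head?_eq_getElem?, getElem?_wordFactor,
      if_pos (by omega), hU]
    rfl
  · rw [hiter, length_wordFactor]
    exact (Nat.lt_pow_self (by omega)).le
  · rw [hiter, length_wordFactor]

theorem isUniform_appendMorphism {U : ℕ → ℕ} {k d : ℕ} (hk : 2 ≤ k) :
    (appendMorphism (wordFactor U 0 (k - 1)) d).IsUniform k := fun c => by
  simp [appendMorphism]; omega

/-- Two occurrences of `x` make their positions compatible letter by letter, so `hloc` forces equal
residues. Any one occurrence therefore supplies `j`. -/
theorem locates_appendMorphism {U : ℕ → ℕ} {k d ℓ : ℕ} (hk : 2 ≤ k)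
    (hloc : ∀ p q, p % k ≠ q % k → ∃ i < ℓ, ¬ Compat U k d (p + i) (q + i)) :
    (appendMorphism (wordFactor U 0 (k - 1)) d).Locates k ℓ := by
  intro x hx
  have key : ∀ w p s i e, (appendMorphism (wordFactor U 0 (k - 1)) d).onWord w = p ++ x ++ s →
      x[i]? = some e → FitsAt U k d (p.length + i) e := fun w p s i e h he => by
    apply fitsAt_onWord hk w
    have hi : i < x.length := by
      by_contra hi
      rw [List.getElem?_eq_none (by omega)] at he
      cases he
    rw [h, List.append_assoc, List.getElem?_append_right (by omega), Nat.add_sub_cancel_left,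
      List.getElem?_append_left hi, he]
  by_cases hocc : ∃ w p s, (appendMorphism (wordFactor U 0 (k - 1)) d).onWord w = p ++ x ++ s
  · obtain ⟨w₀, p₀, s₀, h₀⟩ := hocc
    refine ⟨p₀.length, fun w p s h => ?_⟩
    by_contra hne
    obtain ⟨i, hi, hi'⟩ := hloc p.length p₀.length fun h => hne (Int.natCast_modEq_iff.2 h)
    exact hi' ⟨x[i], key w p s i _ h (by simp [hx, hi]), key w₀ p₀ s₀ i _ h₀ (by simp [hx, hi])⟩
  · exact ⟨0, fun w p s h => absurd ⟨w, p, s, h⟩ hocc⟩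

/-! ### Power-freeness by descent -/

/-- Infinite descent on the parameter `m`: a power with long overlap desubstitutes to one with
parameter `m / k`, and short overlaps are impossible. -/
theorem isFracPowerFree_blockWord {U : ℕ → ℕ} {a b k d ℓ : ℕ} (hk : 2 ≤ k) (hba : b < a)
    (hab : a < 2 * b) (hbk : Nat.Coprime k b)
    (hloc : ∀ p q, p % k ≠ q % k → ∃ i < ℓ, ¬ Compat U k d (p + i) (q + i))
    (hfree : ∀ m, 1 ≤ m → (a - b) * m < ℓ → ∀ p,
      ∃ i < (a - b) * m, ¬ Compat U k d (p + i) (p + i + b * m)) :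
    IsFracPowerFree a b (blockWord U k d) := by
  intro p n hpow
  obtain ⟨m, hm, -, h⟩ := (isFracPower_wordFactor_iff hba hab _ _ _).1 hpow
  clear hpow
  have hcompat : ∀ {x y}, blockWord U k d x = blockWord U k d y → Compat U k d x y :=
    fun {x y} hxy => ⟨_, fitsAt_blockWord hk x, hxy ▸ fitsAt_blockWord hk y⟩
  induction m using Nat.strong_induction_on generalizing p with
  | _ m ih =>
    rcases lt_or_ge ((a - b) * m) ℓ with hl | hl
    · obtain ⟨i, hi, hi'⟩ := hfree m hm hl p
      exact hi' (hcompat (h i hi))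
    -- The overlap and its copy at distance `b * m` contain equal windows of length `ℓ`, so location
    -- makes the distance a multiple of `k`.
    · have hdvd : k ∣ b * m := by
        by_contra hnd
        obtain ⟨i, hi, hi'⟩ := hloc p (p + b * m) fun hmod =>
          hnd ((Nat.modEq_iff_dvd' (by omega)).1 hmod |>.trans (by simp))
        exact hi' (by
          have := hcompat (h i (by omega))
          rwa [add_right_comm] at this)
      obtain ⟨m', rfl⟩ := hbk.dvd_of_dvd_mul_left hdvd
      have hm' : 1 ≤ m' := by
        rcases Nat.eq_zero_or_pos m' with rfl | h'
        · simp at hm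
        · exact h'
      refine ih m' (by nlinarith) (p / k) hm' fun j hj => ?_
      have hr := Nat.mod_lt p (show 0 < k by omega)
      have hp := Nat.div_add_mod p k
      have hj2 : k * j + k ≤ (a - b) * (k * m') := by
        calc k * j + k = k * (j + 1) := by ring
          _ ≤ k * ((a - b) * m') := Nat.mul_le_mul_left k hj
          _ = _ := by ring
      -- This offset leads from `p` to the end of block `p / k + j`. An overlap of length `k * ((a -
      -- b) * m')` contains `(a - b) * m'` block ends.
      have := h (k - 1 - p % k + k * j) (by omega)
      have e1 : p + (k - 1 - p % k + k * j) = k * (p / k + j) + (k - 1) := by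
        rw [mul_add]; omega
      have e2 : p + (k - 1 - p % k + k * j) + b * (k * m') =
          k * (p / k + j + b * m') + (k - 1) := by
        rw [e1]; ring
      rw [e2, e1, blockWord_last hk, blockWord_last hk] at this
      omega

/-! ### Lexicographic minimality -/

/-- Replacing the letter of `w` at position `n` by `c` closes an `a/b`-power. -/
def ClosesPower (a b : ℕ) (w : ℕ → ℕ) (n c : ℕ) : Prop :=
  ∃ m, 1 ≤ m ∧ a * m ≤ n + 1 ∧ w (n - b * m) = c ∧
    ∀ i, i + 1 < (a - b) * m → w (n + 1 - a * m + i) = w (n + 1 - a * m + i + b * m)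

/-- Strong induction on the position: a letter `c ≥ d` at the end of a block reduces to the letter
`c - d` at position `n / k`, whose closing power is enlarged `k`-fold by the morphism. -/
theorem closesPower_blockWord {U : ℕ → ℕ} {a b k d : ℕ} (hk : 2 ≤ k) (hb : 0 < b) (hba : b < a)
    (hleast : ∀ j < k, ∀ c < if j + 1 = k then d else U j, ClosesPower a b U j c)
    (n c : ℕ) (hc : c < blockWord U k d n) : ClosesPower a b (blockWord U k d) n c := by
  have hsplit : ∀ m, a * m = b * m + (a - b) * m := fun m => by
    rw [← add_mul]; congr 1; omega
  have hpos : ∀ m, 1 ≤ m → 0 < b * m ∧ 0 < (a - b) * m := fun m hm =>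
    ⟨Nat.mul_pos hb hm, Nat.mul_pos (by omega) hm⟩
  induction n using Nat.strong_induction_on generalizing c with
  | _ n ih =>
    have hr := Nat.mod_lt n (show 0 < k by omega)
    have hn := Nat.div_add_mod n k
    -- Only letters strictly before the closing position are inspected, and within a block these are
    -- letters of `U`.
    have lift : ClosesPower a b U (n % k) c → ClosesPower a b (blockWord U k d) n c := by
      rintro ⟨m, hm, hle, hlast, hrun⟩
      have hs := hsplit m
      have hp := hpos m hm
      refine ⟨m, hm, by omega, ?_, fun i hi => ?_⟩
      · rw [show n - b * m = k * (n / k) + (n % k - b * m) by omega, blockWord_inner _ (by omega),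
          hlast]
      · have := hrun i hi
        rw [show n + 1 - a * m + i = k * (n / k) + (n % k + 1 - a * m + i) by omega, add_assoc,
          blockWord_inner _ (by omega), blockWord_inner _ (by omega), this]
    by_cases hlast : n % k + 1 = k
    · rcases lt_or_ge c d with hcd | hcd
      · exact lift (hleast _ hr _ (by rwa [if_pos hlast]))
      · rw [blockWord_of_mod_eq hk hlast] at hc
        have hlt : n / k < n := by
          have : n / k * 2 ≤ n / k * k := Nat.mul_le_mul_left _ hk
          rw [mul_comm _ k] at this
          omega
        obtain ⟨m, hm, hle, hl, hrun⟩ := ih (n / k) hlt (c - d) (by omega)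
        have hs := hsplit m
        have hp := hpos m hm
        have hn1 : n + 1 = k * (n / k + 1) := by rw [mul_add]; omega
        have hx : n + 1 - a * (k * m) = k * (n / k + 1 - a * m) := by
          rw [hn1, Nat.mul_sub]; congr 1; ring
        refine ⟨k * m, Nat.mul_pos (by omega) hm, ?_, ?_, fun i hi => ?_⟩
        · rw [hn1, show a * (k * m) = k * (a * m) by ring]
          exact Nat.mul_le_mul_left k hle
        · have : n - b * (k * m) = k * (n / k - b * m) + (k - 1) := by
            rw [Nat.mul_sub, show b * (k * m) = k * (b * m) by ring]
            have : k * (b * m) ≤ k * (n / k) := Nat.mul_le_mul_left k (by omega)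
            omega
          rw [this, blockWord_last hk, hl]
          omega
        · have hi1 := Nat.div_add_mod i k
          have hi2 := Nat.mod_lt i (show 0 < k by omega)
          set x := n / k + 1 - a * m with hxdef
          have e1 : n + 1 - a * (k * m) + i = k * (x + i / k) + i % k := by
            rw [hx, mul_add]; omega
          have e2 : n + 1 - a * (k * m) + i + b * (k * m) = k * (x + i / k + b * m) + i % k := by
            rw [e1]; ring
          rw [e2, e1]
          -- Both positions have the same offset in their blocks: block ends agree by the smaller
          -- power, inner letters because they depend on the offset alone.
          by_cases hik : i % k + 1 = k
          · have hlt2 : i / k + 1 < (a - b) * m := by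
              have : k * (i / k + 1) < k * ((a - b) * m) := by
                calc k * (i / k + 1) = i + 1 := by rw [mul_add]; omega
                  _ < (a - b) * (k * m) := hi
                  _ = _ := by ring
              exact Nat.lt_of_mul_lt_mul_left this
            have hik' : i % k = k - 1 := by omega
            rw [hik', blockWord_last hk, blockWord_last hk, hrun _ hlt2]
          · rw [blockWord_inner _ (by omega), blockWord_inner _ (by omega)]
    · refine lift (hleast _ hr _ ?_)
      rwa [if_neg hlast, ← blockWord_of_mod_ne (U := U) (d := d) hlast]

theorem isLexLeast_of_closesPower {a b : ℕ} {w : ℕ → ℕ} (hba : b < a) (hab : a < 2 * b)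
    (hfree : IsFracPowerFree a b w) (hcl : ∀ n, ∀ c < w n, ClosesPower a b w n c) :
    IsLexLeastFracPowerFree a b w := by
  refine ⟨hfree, fun v hv => ?_⟩
  by_contra hlt
  rw [not_le] at hlt
  obtain ⟨n, heq, hn⟩ := hlt
  obtain ⟨m, hm, hle, hlast, hrun⟩ := hcl n _ hn
  have hsplit : a * m = b * m + (a - b) * m := by
    rw [← add_mul]; congr 1; omega
  have hp1 : 0 < b * m := Nat.mul_pos (by omega) hm
  have heq' : ∀ j < n, ofLex v j = w j := heq
  refine hv (n + 1 - a * m) (a * m) ((isFracPower_wordFactor_iff hba hab _ _ _).2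
    ⟨m, hm, rfl, fun i hi => ?_⟩)
  rw [heq' _ (by omega)]
  -- Only the last comparison involves position `n`, where `v` has the letter that closes the power.
  by_cases hi' : i + 1 < (a - b) * m
  · rw [heq' _ (by omega), hrun i hi']
  · rw [show n + 1 - a * m + i = n - b * m by omega, show n - b * m + b * m = n by omega, hlast]
    rfl

theorem describes_of_compat {U : ℕ → ℕ} {a b k d ℓ : ℕ} (hk : 2 ≤ k) (hba : b < a)
    (hab : a < 2 * b) (hbk : Nat.Coprime k b) (hU : U 0 = 0)
    (hloc : ∀ p q, p % k ≠ q % k → ∃ i < ℓ, ¬ Compat U k d (p + i) (q + i))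
    (hfree : ∀ m, 1 ≤ m → (a - b) * m < ℓ → ∀ p,
      ∃ i < (a - b) * m, ¬ Compat U k d (p + i) (p + i + b * m))
    (hleast : ∀ j < k, ∀ c < if j + 1 = k then d else U j, ClosesPower a b U j c) :
    Describes a b d k ℓ (wordFactor U 0 (k - 1)) :=
  ⟨isUniform_appendMorphism hk,
    ⟨blockWord U k d,
      isLexLeast_of_closesPower hba hab (isFracPowerFree_blockWord hk hba hab hbk hloc hfree)
        (closesPower_blockWord hk (by omega) hba hleast),
      isIterationLimit_blockWord hk hU⟩,
    locates_appendMorphism hk hloc⟩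

/-! ### Bit-vector routines -/

/-- Extends the bit vector `Y` of length `p` periodically to length `len`. -/
def repeatBits (Y p len : ℕ) : ℕ :=
  Nat.mod (Nat.mul Y (Nat.div (2 ^ (p * (len / p + 1)) - 1) (2 ^ p - 1))) (2 ^ len)

/-- The indicator of the letter `c` in a word given by Lempel-Ziv phrases: the phrase
`(p, len, e)` continues the word of length `n` with period `p` for `len` letters and then appends
the letter `e`. -/
def decodeBits (c : ℕ) : List (ℕ × ℕ × ℕ) → ℕ → ℕ → ℕ
  | [], _, X => X
  | (p, len, e) :: t, n, X =>
    decodeBits c t (n + len + 1)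
      (Nat.lor X (Nat.shiftLeft (Nat.lor (repeatBits (Nat.shiftRight X (n - p)) p len)
        (Nat.shiftLeft (cond (Nat.beq e c) 1 0) len)) n))

/-- If `M` is the indicator of the positions where runs of length `t` begin, the indicator of the
positions where runs of length `L` begin. -/
def runBits : ℕ → ℕ → ℕ → ℕ → ℕ
  | 0, t, L, M => Nat.land M (Nat.shiftRight M (Nat.sub L t))
  | f + 1, t, L, M =>
    cond (Nat.beq M 0) 0
      (cond (Nat.ble (Nat.add t t) L) (runBits f (Nat.add t t) L (Nat.land M (Nat.shiftRight M t)))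
        (Nat.land M (Nat.shiftRight M (Nat.sub L t))))

/-- `P` holds on the `2 ^ n` numbers from `lo` on. -/
def allFrom (P : ℕ → Bool) : ℕ → ℕ → Bool
  | 0, lo => P lo
  | n + 1, lo => and (allFrom P n lo) (allFrom P n (Nat.add lo (Nat.pow 2 n)))

/-! ### Certificates and their boolean checks -/

/-- The parameters of a morphism `n ↦ u (n + d)` on blocks of length `k`, where `u` is a word on the
letters `0`, `1`, `2`, together with data for verifying its properties. -/
structure BlockCode where
  a : ℕ
  b : ℕ
  d : ℕ
  k : ℕ
  ℓ : ℕ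
  /-- sample blocks have length `2 ^ depth` -/
  depth : ℕ
  /-- Lempel-Ziv phrases of `u` -/
  phrases : List (ℕ × ℕ × ℕ)
  /-- the powers with these parameters show that `u` is lexicographically least -/
  periods : List ℕ

namespace BlockCode

variable (C : BlockCode)

/-- The indicator of the letter `c ≤ 2` in `u`. -/
def plane : ℕ → ℕ
  | 0 => Nat.xor (2 ^ (C.k - 1) - 1)
      (Nat.lor (decodeBits 1 C.phrases 0 0) (decodeBits 2 C.phrases 0 0))
  | c + 1 => decodeBits (c + 1) C.phrases 0 0

/-- The indicator of the positions in a block where the letter `c ≤ 2` can occur. -/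
def wild (c : ℕ) : ℕ :=
  Nat.lor (C.plane c) (cond (Nat.ble C.d c) (2 ^ (C.k - 1)) 0)

/-- `wild` for two consecutive blocks. -/
def double (c : ℕ) : ℕ :=
  Nat.lor (C.wild c) (Nat.shiftLeft (C.wild c) C.k)

/-- `wild` for three consecutive blocks. -/
def triple (c : ℕ) : ℕ :=
  Nat.lor (C.double c) (Nat.shiftLeft (C.wild c) (2 * C.k))

/-- The indicator of the positions in two blocks that are compatible with the position `s` later. -/
def agree (s : ℕ) : ℕ :=
  Nat.lor (Nat.land (C.double 0) (Nat.shiftRight (C.triple 0) s))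
    (Nat.lor (Nat.land (C.double 1) (Nat.shiftRight (C.triple 1) s))
      (Nat.land (C.double 2) (Nat.shiftRight (C.triple 2) s)))

/-- No `a/b`-power with parameter `m` and overlap less than `ℓ` occurs in an image. -/
def freeAt (m : ℕ) : Bool :=
  or (Nat.beq m 0) (or (Nat.ble C.ℓ ((C.a - C.b) * m))
    (Nat.beq (runBits 16 1 ((C.a - C.b) * m) (C.agree (C.b * m % C.k))) 0))

/-- No `a/b`-power with parameter `m` from `1024 * i` to `1024 * i + 1023` and overlap less than `ℓ`
occurs in an image. -/
def free (i : ℕ) : Bool := allFrom C.freeAt 10 (1024 * i)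

/-- The shifts under which the position `i` and its image can both have the letter `c`. -/
def shiftsPart (i c : ℕ) : ℕ :=
  cond (Nat.beq (Nat.mod (Nat.shiftRight (C.double c) i) 2) 1) (Nat.shiftRight (C.double c) i) 0

/-- The shifts under which the position `i` is compatible with its image. -/
def shiftsAt (i : ℕ) : ℕ :=
  cond (Nat.beq (Nat.mod (Nat.shiftRight (C.double 0) i) 2) 1) (Nat.shiftRight (C.double 0) i)
    (Nat.lor (C.shiftsPart i 1) (C.shiftsPart i 2))

/-- The shifts under which the `2 ^ n` positions from `x` on are compatible with their images. -/
def shiftsFrom : ℕ → ℕ → ℕ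
  | 0, x => C.shiftsAt (x % C.k)
  | n + 1, x => Nat.land (shiftsFrom n x) (shiftsFrom n (Nat.add x (Nat.pow 2 n)))

/-- The distance of sample blocks. -/
def gap : ℕ := C.ℓ - 2 ^ C.depth + 1

/-- The shifts under which one of the first `h` sample blocks is compatible with its image. -/
def sampleShifts : ℕ → ℕ
  | 0 => 0
  | h + 1 => Nat.lor (sampleShifts h) (C.shiftsFrom C.depth (C.gap * h))

/-- No shift `lo + i` other than `0` with `i` in the set `S` of numbers less than `2 ^ n` is
compatible with a word of length `ℓ`. -/
def checkShifts : ℕ → ℕ → ℕ → Bool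
  | 0, lo, S =>
    or (Nat.beq S 0) (or (Nat.beq lo 0) (Nat.beq (runBits 16 1 C.ℓ (C.agree lo)) 0))
  | n + 1, lo, S =>
    or (Nat.beq S 0)
      (and (checkShifts n lo (Nat.mod S (Nat.pow 2 (Nat.pow 2 n))))
        (checkShifts n (Nat.add lo (Nat.pow 2 n)) (Nat.shiftRight S (Nat.pow 2 n))))

/-- Words of length `ℓ` are located. -/
def locating : Bool :=
  C.checkShifts 16 0
    (Nat.land (C.sampleShifts (C.k / C.gap + 2)) (2 ^ (C.k / 2 + 1) - 1))

/-- The indicator of the positions in `u` whose letter is repeated at the position `s` later. -/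
def agreeInside (s : ℕ) : ℕ :=
  Nat.lor (Nat.land (C.plane 0) (Nat.shiftRight (C.plane 0) s))
    (Nat.lor (Nat.land (C.plane 1) (Nat.shiftRight (C.plane 1) s))
      (Nat.land (C.plane 2) (Nat.shiftRight (C.plane 2) s)))

/-- The positions where the letter `c` closes a power with one of the given parameters. -/
def closed (c : ℕ) : List ℕ → ℕ
  | [] => 0
  | m :: t =>
    Nat.lor (closed c t) (Nat.shiftLeft
      (Nat.land (runBits 16 1 ((C.a - C.b) * m - 1) (C.agreeInside (C.b * m)))
        (Nat.shiftRight (C.plane c) ((C.a - C.b) * m - 1))) (C.a * m - 1))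

/-- Each letter less than a letter of `u`, or than `d` after `u`, closes a power. -/
def least : Bool :=
  and (Nat.beq (Nat.lor (C.closed 0 C.periods)
      (Nat.lor (C.plane 1) (Nat.lor (C.plane 2) (2 ^ (C.k - 1))))) (C.closed 0 C.periods))
    (Nat.beq (Nat.lor (C.closed 1 C.periods)
      (Nat.lor (C.plane 2) (cond (Nat.ble C.d 1) 0 (2 ^ (C.k - 1))))) (C.closed 1 C.periods))

end BlockCode

/-! ### Correctness of the bit-vector routines -/

/-- Since `s ≤ t`, two runs of length `t` at distance `s` leave no gap and cover a run of length `t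
+ s`. -/
theorem testBit_runs_add {N t M : ℕ}
    (hM : ∀ p, M.testBit p = true ↔ ∀ i < t, N.testBit (p + i) = true) {s : ℕ} (hs : s ≤ t)
    (p : ℕ) : (M &&& M >>> s).testBit p = true ↔ ∀ i < t + s, N.testBit (p + i) = true := by
  rw [Nat.testBit_land, Nat.testBit_shiftRight, Bool.and_eq_true, hM, hM]
  constructor
  · rintro ⟨h1, h2⟩ i hi
    by_cases h : i < t
    · exact h1 i h
    · have := h2 (i - s) (by omega)
      rwa [show s + p + (i - s) = p + i by omega] at this
  · intro h
    refine ⟨fun i hi => h i (by omega), fun i hi => ?_⟩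
    rw [show s + p + i = p + (i + s) by omega]
    exact h _ (by omega)

/-- The length doubles while it stays at most `L`; one last shift by `L - t ≤ t` then reaches `L`
exactly. The bound on `L` guarantees that the fuel `f` suffices. -/
theorem testBit_runBits {N : ℕ} {f t L M : ℕ} (ht : 1 ≤ t) (htL : t ≤ L) (hL : L ≤ 2 ^ (f + 1) * t)
    (hM : ∀ p, M.testBit p = true ↔ ∀ i < t, N.testBit (p + i) = true) (p : ℕ) :
    (runBits f t L M).testBit p = true ↔ ∀ i < L, N.testBit (p + i) = true := by
  induction f generalizing t M with
  | zero =>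
    have := testBit_runs_add hM (s := L - t) (by omega) p
    rwa [show t + (L - t) = L by omega] at this
  | succ f ih =>
    rw [runBits]
    cases h0 : Nat.beq M 0 with
    | true =>
      rw [Nat.beq_eq] at h0
      subst h0
      simp only [cond_true, Nat.zero_testBit, Bool.false_eq_true, false_iff]
      intro h
      simpa using (hM p).2 fun i hi => h i (by omega)
    | false =>
      cases h1 : Nat.ble (Nat.add t t) L with
      | true =>
        rw [Nat.ble_eq] at h1
        refine ih (t := t + t) (by omega) h1 ?_ (testBit_runs_add hM le_rfl)
        rw [pow_succ] at hL
        linarith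
      | false =>
        have h1' : ¬ t + t ≤ L := fun h => by
          rw [← Nat.ble_eq] at h
          exact absurd (h1.symm.trans h) (by simp)
        have := testBit_runs_add hM (s := L - t) (by omega) p
        rwa [show t + (L - t) = L by omega] at this

theorem testBit_runBits_one {L : ℕ} (hL : 1 ≤ L) (hL' : L ≤ 65536) (N p : ℕ) :
    (runBits 16 1 L N).testBit p = true ↔ ∀ i < L, N.testBit (p + i) = true :=
  testBit_runBits le_rfl hL (by omega) (fun p => by simp) p

theorem allFrom_sound {P : ℕ → Bool} {n lo : ℕ} (h : allFrom P n lo = true) {m : ℕ}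
    (hm : lo ≤ m) (hm' : m < lo + 2 ^ n) : P m = true := by
  induction n generalizing lo with
  | zero =>
    obtain rfl : m = lo := by simp at hm'; omega
    exact h
  | succ n ih =>
    obtain ⟨h1, h2⟩ := (Bool.and_eq_true _ _).mp h
    change allFrom P n (lo + 2 ^ n) = true at h2
    rw [pow_succ] at hm'
    by_cases hlt : m < lo + 2 ^ n
    · exact ih h1 hm hlt
    · exact ih h2 (by omega) (by omega)

/-! ### Soundness of the checks -/

namespace BlockCode

variable (C : BlockCode)

/-- The letter of `u` at position `j`. -/
def letter (j : ℕ) : ℕ :=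
  if (C.plane 1).testBit j then 1 else if (C.plane 2).testBit j then 2 else 0

/-- The word `u`. -/
def word : List ℕ := wordFactor C.letter 0 (C.k - 1)

/-- The numerical conditions on the parameters and the bit planes. -/
def valid : Bool :=
  decide ((2 ≤ C.k ∧ C.k ≤ 65536 ∧ C.ℓ ≤ C.k ∧ 2 ^ C.depth ≤ C.ℓ) ∧
    (C.b + 2 ≤ C.a ∧ C.a < 2 * C.b ∧ Nat.gcd C.k C.b = 1) ∧ (1 ≤ C.d ∧ C.d ≤ 2) ∧
    (C.plane 1 < 2 ^ (C.k - 1) ∧ C.plane 2 < 2 ^ (C.k - 1) ∧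
      Nat.land (C.plane 1) (C.plane 2) = 0 ∧ C.plane 1 % 2 = 0 ∧ C.plane 2 % 2 = 0) ∧
    ∀ m ∈ C.periods, 1 ≤ m ∧ C.a * m ≤ C.k)

variable {C}

theorem letter_le (j : ℕ) : C.letter j ≤ 2 := by
  unfold letter; split_ifs <;> omega

theorem testBit_sampleShifts {H h s : ℕ} (hH : h < H)
    (hs : (C.shiftsFrom C.depth (C.gap * h)).testBit s = true) :
    (C.sampleShifts H).testBit s = true := by
  induction H with
  | zero => omega
  | succ H ih =>
    change (C.sampleShifts H ||| _).testBit s = true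
    rw [Nat.testBit_lor, Bool.or_eq_true]
    rcases Nat.lt_succ_iff_lt_or_eq.1 hH with h' | rfl
    exacts [Or.inl (ih h'), Or.inr hs]

/-- Disjointness of the planes of `1` and `2` makes `letter` agree with both, and the plane of `0`
is their complement in the first `k - 1` places. Nothing about the decompression is needed: `valid`
tests the decoded planes themselves. -/
theorem testBit_plane (hC : C.valid = true) {c : ℕ} (hc : c ≤ 2) (j : ℕ) :
    (C.plane c).testBit j = true ↔ j + 1 < C.k ∧ C.letter j = c := by
  obtain ⟨-, -, -, ⟨h1, h2, h12, -, -⟩, -⟩ := of_decide_eq_true hC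
  replace h12 : C.plane 1 &&& C.plane 2 = 0 := h12
  have hlt : ∀ {X}, X < 2 ^ (C.k - 1) → X.testBit j = true → j + 1 < C.k := fun hX hj => by
    by_contra hcon
    rw [Nat.testBit_lt_two_pow (hX.trans_le (Nat.pow_le_pow_right two_pos (by omega)))] at hj
    cases hj
  have hdisj : ¬ ((C.plane 1).testBit j = true ∧ (C.plane 2).testBit j = true) := by
    rw [← Bool.and_eq_true, ← Nat.testBit_land]
    simp [h12]
  have h0 : (C.plane 0).testBit j = true ↔ j + 1 < C.k ∧
      ¬ ((C.plane 1).testBit j = true ∨ (C.plane 2).testBit j = true) := by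
    have : C.plane 0 = (2 ^ (C.k - 1) - 1) ^^^ (C.plane 1 ||| C.plane 2) := rfl
    rw [this, Nat.testBit_xor, Nat.testBit_two_pow_sub_one, Nat.testBit_lor,
      ← Bool.or_eq_true]
    have hor : ((C.plane 1).testBit j || (C.plane 2).testBit j) = true → j + 1 < C.k := by
      rw [Bool.or_eq_true]; rintro (h | h)
      exacts [hlt h1 h, hlt h2 h]
    cases hb : ((C.plane 1).testBit j || (C.plane 2).testBit j) with
    | true => simp [show j < C.k - 1 by have := hor hb; omega]
    | false => simp; omega
  unfold letter
  have h1' := hlt (X := C.plane 1) h1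
  have h2' := hlt (X := C.plane 2) h2
  interval_cases c
  · rw [h0]; split_ifs <;> simp_all
  · split_ifs <;> simp_all
  · split_ifs <;> simp_all

theorem testBit_wild (hC : C.valid = true) {c : ℕ} (hc : c ≤ 2) (j : ℕ) :
    (C.wild c).testBit j = true ↔ j < C.k ∧ FitsAt C.letter C.k C.d j c := by
  have hk := (of_decide_eq_true hC).1.1
  change (C.plane c ||| _).testBit j = true ↔ _
  rw [Nat.testBit_lor, Bool.or_eq_true, testBit_plane hC hc]
  have hcond : (cond (Nat.ble C.d c) (2 ^ (C.k - 1)) 0).testBit j = true ↔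
      C.d ≤ c ∧ j + 1 = C.k := by
    cases h : Nat.ble C.d c with
    | true =>
      rw [Nat.ble_eq] at h
      simp only [cond_true, Nat.testBit_two_pow, decide_eq_true_eq, h, true_and]
      omega
    | false =>
      have : ¬ C.d ≤ c := fun h' => by
        rw [← Nat.ble_eq] at h'
        exact absurd (h.symm.trans h') (by simp)
      simp [this]
  rw [hcond]
  unfold FitsAt
  by_cases hj : j < C.k
  · rw [Nat.mod_eq_of_lt hj]
    split_ifs with h
    · simp [h, hj]
    · simp only [h, and_false, or_false, hj, true_and, show j + 1 < C.k by omega]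
      exact eq_comm
  · simp only [hj, false_and, iff_false]
    omega

theorem testBit_double (hC : C.valid = true) {c i : ℕ} (hc : c ≤ 2) (hi : i < 2 * C.k) :
    (C.double c).testBit i = true ↔ FitsAt C.letter C.k C.d i c := by
  change (C.wild c ||| C.wild c <<< C.k).testBit i = true ↔ _
  rw [Nat.testBit_lor, Bool.or_eq_true, Nat.testBit_shiftLeft, Bool.and_eq_true,
    testBit_wild hC hc, testBit_wild hC hc, decide_eq_true_eq]
  by_cases h : i < C.k
  · simp [h]
  · have : FitsAt C.letter C.k C.d (i - C.k) c ↔ FitsAt C.letter C.k C.d i c := by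
      unfold FitsAt; rw [← Nat.mod_eq_sub_mod (by omega)]
    rw [this]
    simp only [h, false_and, false_or]
    constructor
    · exact fun h => h.2.2
    · exact fun h' => ⟨by omega, by omega, h'⟩

theorem testBit_triple (hC : C.valid = true) {c i : ℕ} (hc : c ≤ 2) (hi : i < 3 * C.k)
    (h : FitsAt C.letter C.k C.d i c) : (C.triple c).testBit i = true := by
  change (C.double c ||| C.wild c <<< (2 * C.k)).testBit i = true
  rw [Nat.testBit_lor, Bool.or_eq_true, Nat.testBit_shiftLeft, Bool.and_eq_true,
    testBit_wild hC hc, decide_eq_true_eq]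
  by_cases h' : i < 2 * C.k
  · exact Or.inl ((testBit_double hC hc h').2 h)
  · refine Or.inr ⟨by omega, by omega, ?_⟩
    unfold FitsAt at h ⊢
    rwa [Nat.mod_eq_sub_mod (by omega), Nat.mod_eq_sub_mod (by omega), Nat.sub_sub,
      ← two_mul] at h

/-- A common letter above `2` can only stand at two block ends, and there `2` fits as well because
`d ≤ 2`. Hence three planes decide compatibility over the infinite alphabet. -/
theorem exists_fitsAt_le_two (hC : C.valid = true) {p q : ℕ} (h : Compat C.letter C.k C.d p q) :
    ∃ c ≤ 2, FitsAt C.letter C.k C.d p c ∧ FitsAt C.letter C.k C.d q c := by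
  have hd := (of_decide_eq_true hC).2.2.1.2
  obtain ⟨e, hp, hq⟩ := h
  by_cases he : e ≤ 2
  · exact ⟨e, he, hp, hq⟩
  · have h1 := C.letter_le (p % C.k)
    have h2 := C.letter_le (q % C.k)
    unfold FitsAt at hp hq ⊢
    refine ⟨2, le_rfl, ?_⟩
    split_ifs at hp hq ⊢ <;> omega

theorem testBit_agree (hC : C.valid = true) {i s : ℕ} (hi : i < 2 * C.k) (hs : s < C.k)
    (h : Compat C.letter C.k C.d i (i + s)) : (C.agree s).testBit i = true := by
  obtain ⟨c, hc, h1, h2⟩ := exists_fitsAt_le_two hC h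
  have hbit : (C.double c &&& C.triple c >>> s).testBit i = true := by
    rw [Nat.testBit_land, Bool.and_eq_true, Nat.testBit_shiftRight, add_comm s]
    exact ⟨(testBit_double hC hc hi).2 h1, testBit_triple hC hc (by omega) h2⟩
  change (C.double 0 &&& C.triple 0 >>> s ||| (C.double 1 &&& C.triple 1 >>> s |||
    C.double 2 &&& C.triple 2 >>> s)).testBit i = true
  rw [Nat.testBit_lor, Nat.testBit_lor, Bool.or_eq_true, Bool.or_eq_true]
  interval_cases c
  exacts [Or.inl hbit, Or.inr (Or.inl hbit), Or.inr (Or.inr hbit)]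

/-- After reducing `p` modulo `k`, a window of length `L ≤ k` stays inside two blocks, and its image
under a shift `s < k` inside three; this is why `agree` combines `double` with `triple`. -/
theorem exists_not_compat (hC : C.valid = true) {s L : ℕ} (hs : s < C.k) (hL : 1 ≤ L)
    (hL' : L ≤ C.k) (h : Nat.beq (runBits 16 1 L (C.agree s)) 0 = true) (p : ℕ) :
    ∃ i < L, ¬ Compat C.letter C.k C.d (p + i) (p + i + s) := by
  obtain ⟨hk, hk', -⟩ := (of_decide_eq_true hC).1
  by_contra! hcon
  have hp := Nat.mod_lt p (show 0 < C.k by omega)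
  have := (testBit_runBits_one hL (hL'.trans hk') (C.agree s) (p % C.k)).2 fun i hi =>
    testBit_agree hC (by omega) hs ((compat_congr (by simp) (by simp [add_assoc])).1 (hcon i hi))
  rw [Nat.beq_eq] at h
  simp [h] at this

theorem free_sound (hC : C.valid = true) {m : ℕ} (h : C.freeAt m = true) (hm : 1 ≤ m)
    (hl : (C.a - C.b) * m < C.ℓ) (p : ℕ) :
    ∃ i < (C.a - C.b) * m, ¬ Compat C.letter C.k C.d (p + i) (p + i + C.b * m) := by
  obtain ⟨⟨hk, -, hℓ, -⟩, ⟨hab, -⟩, -⟩ := of_decide_eq_true hC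
  unfold freeAt at h
  rw [Bool.or_eq_true, Bool.or_eq_true, Nat.beq_eq, Nat.ble_eq] at h
  rcases h with h | h | h
  · omega
  · omega
  · obtain ⟨i, hi, hi'⟩ := exists_not_compat hC (Nat.mod_lt _ (by omega))
      (Nat.mul_pos (by omega) hm) (by omega) h p
    exact ⟨i, hi, fun h => hi' ((compat_congr rfl (by simp)).1 h)⟩

theorem testBit_shiftsPart (hC : C.valid = true) {i s c : ℕ} (hc : c ≤ 2) (hi : i < C.k)
    (hs : s < C.k) (h1 : FitsAt C.letter C.k C.d i c) (h2 : FitsAt C.letter C.k C.d (i + s) c) :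
    (C.shiftsPart i c).testBit s = true := by
  have hb : Nat.beq (Nat.mod (Nat.shiftRight (C.double c) i) 2) 1 = true := by
    rw [Nat.beq_eq]
    have := (testBit_double hC hc (by omega)).2 h1
    rw [Nat.testBit_eq_decide_div_mod_eq, decide_eq_true_eq, ← Nat.shiftRight_eq_div_pow] at this
    exact this
  rw [shiftsPart, hb, cond_true]
  change (C.double c >>> i).testBit s = true
  rw [Nat.testBit_shiftRight]
  exact (testBit_double hC hc (by omega)).2 h2

/-- Since `d ≥ 1`, the letter `0` never fits a block end. A position that admits `0` thus admits no
other letter, and the first branch of `shiftsAt` loses nothing. -/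
theorem testBit_shiftsAt (hC : C.valid = true) {i s : ℕ} (hi : i < C.k) (hs : s < C.k)
    (h : Compat C.letter C.k C.d i (i + s)) : (C.shiftsAt i).testBit s = true := by
  have hd := (of_decide_eq_true hC).2.2.1.1
  obtain ⟨c, hc, h1, h2⟩ := exists_fitsAt_le_two hC h
  have hpart := testBit_shiftsPart hC hc hi hs h1 h2
  unfold shiftsAt
  cases hb : Nat.beq (Nat.mod (Nat.shiftRight (C.double 0) i) 2) 1 with
  | true =>
    obtain rfl : c = 0 := by
      rw [Nat.beq_eq] at hb
      have hb : (C.double 0).testBit i = true := by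
        rw [Nat.testBit_eq_decide_div_mod_eq, decide_eq_true_eq, ← Nat.shiftRight_eq_div_pow]
        exact hb
      rw [testBit_double hC (by omega) (by omega)] at hb
      unfold FitsAt at hb h1
      split_ifs at hb h1 <;> omega
    rwa [shiftsPart, hb] at hpart
  | false =>
    change (C.shiftsPart i 1 ||| C.shiftsPart i 2).testBit s = true
    rw [Nat.testBit_lor, Bool.or_eq_true]
    interval_cases c
    · rw [shiftsPart, hb] at hpart
      simp at hpart
    · exact Or.inl hpart
    · exact Or.inr hpart

theorem testBit_shiftsFrom (hC : C.valid = true) {n x s : ℕ} (hs : s < C.k)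
    (h : ∀ i < 2 ^ n, Compat C.letter C.k C.d (x + i) (x + i + s)) :
    (C.shiftsFrom n x).testBit s = true := by
  have hk := (of_decide_eq_true hC).1.1
  induction n generalizing x with
  | zero =>
    exact testBit_shiftsAt hC (Nat.mod_lt _ (by omega)) hs
      ((compat_congr (by simp) (by simp)).1 (h 0 (by simp)))
  | succ n ih =>
    change (C.shiftsFrom n x &&& C.shiftsFrom n (x + 2 ^ n)).testBit s = true
    rw [Nat.testBit_land, Bool.and_eq_true]
    rw [pow_succ] at h
    refine ⟨ih fun i hi => h i (by omega), ih fun i hi => ?_⟩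
    rw [add_assoc x]
    exact h _ (by omega)

/-- Bisection of the candidate set: empty halves are skipped, and each surviving nonzero shift
undergoes the full run test. -/
theorem checkShifts_sound (hC : C.valid = true) {n lo S i : ℕ}
    (h : C.checkShifts n lo S = true) (hi : i < 2 ^ n)
    (hS : S.testBit i = true) (hpos : 0 < lo + i) (hlt : lo + i < C.k) (p : ℕ) :
    ∃ j < C.ℓ, ¬ Compat C.letter C.k C.d (p + j) (p + j + (lo + i)) := by
  obtain ⟨-, -, hℓ, hdepth⟩ := (of_decide_eq_true hC).1
  have hS0 : ¬ Nat.beq S 0 = true := fun h0 => by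
    rw [Nat.beq_eq] at h0
    simp [h0] at hS
  induction n generalizing lo S i with
  | zero =>
    obtain rfl : i = 0 := by simpa using hi
    rw [checkShifts, Bool.or_eq_true, Bool.or_eq_true] at h
    rcases h with h | h | h
    · exact absurd h hS0
    · rw [Nat.beq_eq] at h; omega
    · exact exists_not_compat hC hlt (Nat.one_le_two_pow.trans hdepth) hℓ h p
  | succ n ih =>
    rw [checkShifts, Bool.or_eq_true, Bool.and_eq_true] at h
    obtain ⟨h1, h2⟩ := h.resolve_left hS0
    change C.checkShifts n lo (S % 2 ^ 2 ^ n) = true at h1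
    change C.checkShifts n (lo + 2 ^ n) (S >>> 2 ^ n) = true at h2
    have hne : ∀ {T j : ℕ}, T.testBit j = true → ¬ Nat.beq T 0 = true := fun hT h0 => by
      rw [Nat.beq_eq] at h0
      simp [h0] at hT
    rw [pow_succ] at hi
    by_cases hin : i < 2 ^ n
    · have hbit : (S % 2 ^ 2 ^ n).testBit i = true := by simp [Nat.testBit_mod_two_pow, hin, hS]
      exact ih h1 hin hbit hpos hlt (hne hbit)
    · have hbit : (S >>> 2 ^ n).testBit (i - 2 ^ n) = true := by
        rwa [Nat.testBit_shiftRight, show 2 ^ n + (i - 2 ^ n) = i by omega]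
      have := ih h2 (by omega) hbit (by omega) (by omega) (hne hbit)
      rwa [show lo + 2 ^ n + (i - 2 ^ n) = lo + i by omega] at this

theorem locating_sound (hC : C.valid = true) (h : C.locating = true) (p q : ℕ)
    (hpq : p % C.k ≠ q % C.k) :
    ∃ i < C.ℓ, ¬ Compat C.letter C.k C.d (p + i) (q + i) := by
  obtain ⟨hk, hk', hℓ, hdepth⟩ := (of_decide_eq_true hC).1
  have hpos := Nat.one_le_two_pow (n := C.depth)
  -- Shifts up to `k / 2` suffice: exchanging the two windows replaces `s` by `k - s` modulo `k`.
  have small : ∀ s, 0 < s → s ≤ C.k / 2 → ∀ p < C.k,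
      ∃ i < C.ℓ, ¬ Compat C.letter C.k C.d (p + i) (p + i + s) := by
    intro s hs hs' p hp
    by_contra! hcon
    have hgap : 0 < C.gap := Nat.succ_pos _
    have hgap' : C.gap + 2 ^ C.depth = C.ℓ + 1 := by unfold gap; omega
    -- The index `g` is `p / gap` rounded up, so sample block `g` begins in `[p, p + gap - 1]`. As
    -- `gap + 2 ^ depth = ℓ + 1`, it lies within the window of length `ℓ` at `p`.
    have hx := Nat.div_add_mod (p + C.gap - 1) C.gap
    have hx' := Nat.mod_lt (p + C.gap - 1) hgap
    set g := (p + C.gap - 1) / C.gap with hg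
    have hH : g < C.k / C.gap + 2 := by
      rw [hg, Nat.div_lt_iff_lt_mul hgap, add_mul]
      have := Nat.div_add_mod C.k C.gap
      have := Nat.mod_lt C.k hgap
      rw [mul_comm (C.k / C.gap)]
      omega
    have hbit := testBit_sampleShifts hH (testBit_shiftsFrom hC (s := s) (by omega) fun i hi => by
      have := hcon (C.gap * g + i - p) (by omega)
      rwa [show p + (C.gap * g + i - p) = C.gap * g + i by omega] at this)
    obtain ⟨j, hj, hj'⟩ := checkShifts_sound hC (i := s) h (by omega) (by
      change (C.sampleShifts _ &&& _).testBit s = true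
      rw [Nat.testBit_land, hbit, Nat.testBit_two_pow_sub_one]
      simp
      omega) (by omega) (by omega) p
    rw [zero_add] at hj'
    exact hj' (hcon j hj)
  have ordered : ∀ p q, p % C.k < q % C.k →
      ∃ i < C.ℓ, ¬ Compat C.letter C.k C.d (p + i) (q + i) := by
    intro p q hlt
    have hq := Nat.mod_lt q (show 0 < C.k by omega)
    by_cases hs : q % C.k - p % C.k ≤ C.k / 2
    · obtain ⟨i, hi, hi'⟩ := small _ (by omega) hs (p % C.k) (by omega)
      refine ⟨i, hi, fun h => hi' ((compat_congr (by simp) ?_).1 h)⟩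
      rw [show p % C.k + i + (q % C.k - p % C.k) = q % C.k + i by omega]
      simp
    · obtain ⟨i, hi, hi'⟩ := small (C.k - (q % C.k - p % C.k)) (by omega) (by omega) (q % C.k) hq
      refine ⟨i, hi, fun h => hi' ((compat_congr (by simp) ?_).1 h.symm)⟩
      rw [show q % C.k + i + (C.k - (q % C.k - p % C.k)) = p % C.k + i + C.k by omega]
      simp
  rcases Nat.lt_or_gt_of_ne hpq with hlt | hlt
  · exact ordered p q hlt
  · obtain ⟨i, hi, hi'⟩ := ordered q p hlt
    exact ⟨i, hi, fun h => hi' h.symm⟩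

theorem letter_eq_of_testBit_agreeInside (hC : C.valid = true) {s i : ℕ}
    (h : (C.agreeInside s).testBit i = true) :
    C.letter i = C.letter (i + s) := by
  change (C.plane 0 &&& C.plane 0 >>> s ||| (C.plane 1 &&& C.plane 1 >>> s |||
    C.plane 2 &&& C.plane 2 >>> s)).testBit i = true at h
  simp only [Nat.testBit_lor, Nat.testBit_land, Nat.testBit_shiftRight, Bool.or_eq_true,
    Bool.and_eq_true, testBit_plane hC (show 0 ≤ 2 by omega),
    testBit_plane hC (show 1 ≤ 2 by omega), testBit_plane hC le_rfl, add_comm s] at h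
  omega

/-- A power ending at `j` begins at `j + 1 - a * m`. All but the last letter of its overlap must
recur inside `u`; the last one is the letter `c` itself, found at `j - b * m`. -/
theorem closesPower_of_testBit_closed (hC : C.valid = true) {c j : ℕ} (hc : c ≤ 2) {ms : List ℕ}
    (hms : ∀ m ∈ ms, 1 ≤ m ∧ C.a * m ≤ C.k) (h : (C.closed c ms).testBit j = true) :
    ClosesPower C.a C.b C.letter j c := by
  obtain ⟨⟨hk, hk', -⟩, ⟨hab, hab', -⟩, -⟩ := of_decide_eq_true hC
  induction ms with
  | nil => simp [closed] at h
  | cons m ms ih =>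
    change (C.closed c ms ||| (runBits 16 1 ((C.a - C.b) * m - 1) (C.agreeInside (C.b * m)) &&&
      C.plane c >>> ((C.a - C.b) * m - 1)) <<< (C.a * m - 1)).testBit j = true at h
    rw [Nat.testBit_lor, Bool.or_eq_true] at h
    rcases h with h | h
    · exact ih (fun m hm => hms m (List.mem_cons_of_mem _ hm)) h
    · obtain ⟨hm, hmk⟩ := hms m List.mem_cons_self
      have hsplit : C.a * m = C.b * m + (C.a - C.b) * m := by
        rw [← add_mul]; congr 1; omega
      -- The run without its last letter must be nonempty for `testBit_runBits_one`; this uses `b +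
      -- 2 ≤ a`.
      have h2 : 2 * 1 ≤ (C.a - C.b) * m := Nat.mul_le_mul (by omega) hm
      rw [Nat.testBit_shiftLeft, Nat.testBit_land, Bool.and_eq_true, Bool.and_eq_true,
        decide_eq_true_eq, testBit_runBits_one (by omega) (by omega), Nat.testBit_shiftRight,
        testBit_plane hC hc] at h
      obtain ⟨hj, hrun, -, hlast⟩ := h
      refine ⟨m, hm, by omega, ?_, fun i hi => ?_⟩
      · rw [← hlast]; congr 1; omega
      · have := letter_eq_of_testBit_agreeInside hC (hrun i (by omega))
        rwa [show j - (C.a * m - 1) = j + 1 - C.a * m by omega] at this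

/-- Letters are at most `2` and `d ≤ 2`, so only `c = 0` and `c = 1` can be smaller. The identities
`X ||| Y = X` in `least` express that the positions needing a closing power are among the closed
ones. -/
theorem least_sound (hC : C.valid = true) (h : C.least = true) (j : ℕ) (hj : j < C.k) (c : ℕ)
    (hc : c < if j + 1 = C.k then C.d else C.letter j) : ClosesPower C.a C.b C.letter j c := by
  obtain ⟨⟨hk, -⟩, -, ⟨-, hd⟩, -, hms⟩ := of_decide_eq_true hC
  rw [least, Bool.and_eq_true, Nat.beq_eq, Nat.beq_eq] at h
  obtain ⟨h0, h1⟩ := h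
  change C.closed 0 C.periods ||| (C.plane 1 ||| (C.plane 2 ||| 2 ^ (C.k - 1))) = _ at h0
  change C.closed 1 C.periods ||| (C.plane 2 ||| cond (Nat.ble C.d 1) 0 (2 ^ (C.k - 1))) = _ at h1
  have hl := C.letter_le j
  have hc2 : c < 2 := by split_ifs at hc <;> omega
  refine closesPower_of_testBit_closed hC (by omega) hms ?_
  interval_cases c
  · rw [← h0]
    simp only [Nat.testBit_lor, Bool.or_eq_true, Nat.testBit_two_pow, decide_eq_true_eq,
      testBit_plane hC (show 1 ≤ 2 by omega), testBit_plane hC le_rfl]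
    split_ifs at hc <;> omega
  · rw [← h1]
    simp only [Nat.testBit_lor, Bool.or_eq_true, testBit_plane hC le_rfl]
    split_ifs at hc with hjk
    · have : Nat.ble C.d 1 = false := by
        rw [← Bool.not_eq_true, Nat.ble_eq]; omega
      rw [this, cond_false, Nat.testBit_two_pow, decide_eq_true_eq]
      omega
    · omega

theorem describes (hC : C.valid = true) (hloc : C.locating = true) (hleast : C.least = true)
    (n : ℕ) (hn : C.ℓ ≤ (C.a - C.b) * (1024 * n)) (hfree : ∀ i < n, C.free i = true) :
    Describes C.a C.b C.d C.k C.ℓ C.word := by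
  obtain ⟨⟨hk, -⟩, ⟨hab, hab', hgcd⟩, -, ⟨-, -, -, h1, h2⟩, -⟩ := of_decide_eq_true hC
  refine describes_of_compat hk (by omega) hab' hgcd ?_ (locating_sound hC hloc)
    (fun m hm hl => free_sound hC ?_ hm hl) (least_sound hC hleast)
  · simp [letter, Nat.testBit_zero, h1, h2]
  · have hmn : m < 1024 * n := Nat.lt_of_mul_lt_mul_left (hl.trans_le hn)
    exact allFrom_sound (hfree (m / 1024) (by omega)) (by omega) (by norm_num; omega)

end BlockCode

/-! ### The 24 certificates -/

namespace BlockCode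

def code_7_4 : BlockCode where
  a := 7
  b := 4
  d := 2
  k := 50847
  ℓ := 12940
  depth := 8
  phrases := [
    (0, 0, 0), (1, 5, 1), (3, 5, 0), (10, 21, 1), (16, 11, 1), (39, 26, 0), (10, 7, 1),
    (33, 28, 1), (62, 151, 1), (16, 11, 2), (72, 31, 0), (75, 9, 2), (32, 23, 1), (294, 722, 1),
    (427, 205, 2), (1250, 26, 0), (455, 20, 0), (10, 22, 2), (458, 45, 0), (1088, 764, 0),
    (294, 235, 1), (2143, 818, 0), (294, 203, 2), (294, 170, 0), (62, 45, 1), (2347, 16, 0),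
    (10, 21, 2), (2304, 1016, 1), (436, 320, 2), (43, 22, 0), (3710, 9252, 1), (14246, 9162, 2),
    (7928, 406, 2), (4600, 3131, 1), (159, 52, 0), (25649, 12893, 0), (62, 44, 2),
    (1855, 176, 1), (25871, 6546, 2), (5312, 3961, 1), (473, 184, 0)]
  periods := [1, 2, 3, 4, 5, 8, 31, 53, 109, 127, 147, 1150, 1328, 1762, 1855, 2634]

theorem describes_7_4 : Describes 7 4 2 50847 12940 code_7_4.word :=
  -- Five ranges of `1024` parameters suffice, since `3 * 1024 * 5 = 15360 ≥ 12940`.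
  describes (C := code_7_4) (by decide +kernel) (by decide +kernel) (by decide +kernel) 5
    (by decide +kernel) fun i hi => by interval_cases i <;> decide +kernel

def code_8_5 : BlockCode where
  a := 8
  b := 5
  d := 2
  k := 733
  ℓ := 301
  depth := 8
  phrases := [
    (0, 0, 0), (1, 6, 1), (3, 5, 0), (9, 11, 0), (11, 5, 1), (32, 30, 2), (20, 11, 1),
    (43, 25, 1), (29, 16, 1), (43, 288, 1), (376, 205, 1), (4, 24, 1), (60, 27, 0), (263, 4, 0),
    (65, 28, 1), (60, 31, 0)]
  periods := [1, 2, 4, 12, 43, 58]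

theorem describes_8_5 : Describes 8 5 2 733 301 code_8_5.word :=
  describes (C := code_8_5) (by decide +kernel) (by decide +kernel) (by decide +kernel) 1
    (by decide +kernel) fun i hi => by interval_cases i; decide +kernel

def code_13_9 : BlockCode where
  a := 13
  b := 9
  d := 1
  k := 45430
  ℓ := 11400
  depth := 9
  phrases := [
    (0, 0, 0), (1, 11, 1), (4, 11, 0), (8, 8, 1), (13, 15, 1), (21, 20, 0), (34, 387, 1),
    (20, 10, 0), (462, 32, 1), (6, 7, 1), (155, 81, 1), (117, 14, 0), (600, 184, 1),
    (296, 11, 0), (13, 154, 1), (913, 411, 0), (21, 18, 1), (598, 315, 1), (47, 25, 2),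
    (18, 7, 2), (650, 273, 1), (1419, 132, 1), (751, 157, 1), (1343, 427, 0), (13, 11, 1),
    (1349, 160, 0), (373, 190, 1), (950, 11287, 1), (13927, 133, 0), (34, 195, 1),
    (1520, 351, 0), (13890, 4497, 1), (4047, 103, 0), (13, 10, 2), (81, 35, 1), (18924, 7596, 1),
    (6683, 177, 2), (324, 143, 1), (76, 63, 1), (27104, 196, 0), (34, 159, 2), (7778, 351, 0),
    (34, 35, 1), (352, 156, 1), (2622, 439, 0), (950, 11377, 1), (13106, 4891, 1), (261, 113, 1),
    (3, 2, 0)]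
  periods := [1, 2, 6, 9, 13, 16, 20, 21, 28, 29, 34, 36, 40, 44, 49, 65, 70, 84, 876,
    910, 950, 1034]

theorem describes_13_9 : Describes 13 9 1 45430 11400 code_13_9.word :=
  describes (C := code_13_9) (by decide +kernel) (by decide +kernel) (by decide +kernel) 3
    (by decide +kernel) fun i hi => by interval_cases i <;> decide +kernel

def code_17_10 : BlockCode where
  a := 17
  b := 10
  d := 2
  k := 55657
  ℓ := 37104
  depth := 8
  phrases := [
    (0, 0, 0), (1, 15, 1), (7, 13, 0), (24, 172, 1), (187, 186, 0), (1, 4, 2), (96, 83, 1),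
    (480, 198, 1), (199, 189, 1), (866, 200, 0), (46, 36, 1), (631, 202, 0), (32, 9, 1),
    (17, 264, 1), (1110, 774, 1), (50, 32, 1), (2393, 201, 2), (813, 196, 0), (2319, 37026, 2),
    (16662, 14909, 1), (54729, 202, 1), (66, 51, 1), (180, 125, 1), (2360, 272, 1),
    (1340, 202, 0), (1972, 49, 0), (24, 19, 0)]
  periods := [1, 2, 3, 5, 7, 9, 10, 12, 17, 18, 111, 2130, 2319]

theorem describes_17_10 : Describes 17 10 2 55657 37104 code_17_10.word :=
  describes (C := code_17_10) (by decide +kernel) (by decide +kernel) (by decide +kernel) 6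
    (by decide +kernel) fun i hi => by interval_cases i <;> decide +kernel

def code_15_11 : BlockCode where
  a := 15
  b := 11
  d := 1
  k := 6168
  ℓ := 711
  depth := 8
  phrases := [
    (0, 0, 0), (1, 13, 1), (4, 11, 0), (8, 10, 1), (15, 15, 1), (23, 22, 0), (38, 511, 1),
    (571, 12, 0), (594, 74, 2), (22, 7, 2), (221, 92, 1), (31, 13, 0), (15, 10, 1), (24, 13, 0),
    (15, 9, 1), (49, 683, 1), (1473, 550, 0), (23, 16, 1), (913, 318, 2), (1305, 402, 1),
    (83, 47, 1), (255, 163, 1), (2982, 556, 1), (2767, 707, 0), (49, 24, 1), (773, 27, 1),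
    (64, 11, 1), (2284, 198, 1), (52, 16, 1), (3950, 15, 0), (2209, 75, 1), (674, 298, 2),
    (1115, 434, 1), (2650, 113, 0), (205, 51, 2), (303, 127, 2), (1908, 485, 1), (3, 1, 0)]
  periods := [1, 2, 3, 11, 12, 16, 20, 32, 38, 40, 41, 48, 49, 81, 83]

theorem describes_15_11 : Describes 15 11 1 6168 711 code_15_11.word :=
  describes (C := code_15_11) (by decide +kernel) (by decide +kernel) (by decide +kernel) 1
    (by decide +kernel) fun i hi => by interval_cases i; decide +kernel

def code_16_13 : BlockCode where
  a := 16
  b := 13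
  d := 1
  k := 12945
  ℓ := 1321
  depth := 8
  phrases := [
    (0, 0, 0), (1, 14, 1), (3, 14, 0), (6, 12, 1), (16, 17, 1), (6, 11, 0), (44, 654, 1),
    (21, 7, 0), (7, 7, 0), (722, 8, 1), (57, 11, 1), (34, 10, 1), (27, 21, 0), (16, 12, 1),
    (16, 8, 1), (28, 27, 0), (28, 14, 1), (95, 14, 0), (111, 21, 1), (35, 18, 1), (155, 9, 1),
    (19, 9, 0), (19, 14, 1), (165, 27, 1), (110, 14, 0), (255, 14, 1), (165, 11, 0),
    (1005, 11, 1), (189, 17, 1), (361, 15, 2), (221, 50, 2), (139, 29, 0), (83, 11, 0),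
    (22, 8, 2), (472, 14, 0), (121, 12, 1), (155, 24, 1), (155, 19, 1), (76, 8, 1),
    (1255, 273, 2), (343, 11, 2), (1177, 346, 1), (44, 14, 0), (1143, 20, 0), (1148, 17, 1),
    (1104, 26, 1), (1132, 640, 2), (1437, 355, 0), (44, 37, 2), (771, 13, 1), (1119, 710, 0),
    (1163, 393, 2), (1119, 768, 0), (1163, 349, 2), (1119, 812, 0), (1163, 305, 2),
    (1119, 856, 0), (44, 198, 1), (969, 622, 1), (7832, 1320, 0), (715, 11, 1), (2999, 30, 0),
    (16, 12, 1), (43, 637, 1), (1855, 336, 1), (481, 109, 1), (1641, 15, 0), (1454, 15, 1),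
    (339, 193, 1), (2111, 14, 0), (296, 12, 1), (1866, 26, 0), (1783, 11, 1), (285, 17, 1),
    (60, 898, 1), (2798, 14, 0), (2210, 497, 1), (1498, 25, 0), (538, 16, 1), (3652, 17, 1),
    (3376, 14, 0), (3376, 13, 1), (3515, 12, 0), (3515, 29, 1), (28, 15, 2), (3515, 17, 0),
    (705, 10, 1), (107, 14, 1), (44, 16, 1), (6071, 19, 1), (3526, 24, 0), (28, 13, 2),
    (3858, 449, 0)]
  periods := [1, 2, 3, 5, 8, 17, 37, 38, 43, 44, 60, 61, 66, 80, 83, 103, 170]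

theorem describes_16_13 : Describes 16 13 1 12945 1321 code_16_13.word :=
  describes (C := code_16_13) (by decide +kernel) (by decide +kernel) (by decide +kernel) 1
    (by decide +kernel) fun i hi => by interval_cases i; decide +kernel

def code_18_13 : BlockCode where
  a := 18
  b := 13
  d := 1
  k := 4188
  ℓ := 2094
  depth := 8
  phrases := [
    (0, 0, 0), (1, 16, 1), (5, 14, 0), (10, 12, 1), (18, 19, 1), (28, 27, 0), (46, 756, 1),
    (830, 16, 0), (858, 112, 1), (38, 16, 0), (123, 20, 0), (25, 25, 1), (28, 16, 0),
    (54, 12, 1), (29, 16, 0), (59, 998, 1), (1236, 125, 0), (2094, 1665, 2), (2094, 303, 0)]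
  periods := [1, 2, 3, 20, 46, 59, 152]

theorem describes_18_13 : Describes 18 13 1 4188 2094 code_18_13.word :=
  describes (C := code_18_13) (by decide +kernel) (by decide +kernel) (by decide +kernel) 1
    (by decide +kernel) fun i hi => by interval_cases i; decide +kernel

def code_19_13 : BlockCode where
  a := 19
  b := 13
  d := 1
  k := 7698
  ℓ := 946
  depth := 8
  phrases := [
    (0, 0, 0), (1, 17, 1), (6, 17, 0), (12, 12, 1), (19, 23, 1), (31, 30, 0), (50, 869, 1),
    (30, 16, 0), (980, 72, 1), (31, 14, 0), (19, 341, 1), (953, 470, 1), (496, 17, 0),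
    (19, 326, 1), (2164, 900, 0), (50, 45, 1), (1292, 344, 0), (961, 578, 1), (2225, 353, 0),
    (773, 413, 1), (4877, 222, 1), (4035, 827, 0), (50, 463, 1), (1292, 845, 1), (26, 11, 1),
    (96, 43, 1), (24, 17, 0), (7300, 252, 1), (271, 131, 0)]
  periods := [1, 2, 5, 10, 17, 19, 33, 40, 50, 71, 81, 84, 97]

theorem describes_19_13 : Describes 19 13 1 7698 946 code_19_13.word :=
  describes (C := code_19_13) (by decide +kernel) (by decide +kernel) (by decide +kernel) 1
    (by decide +kernel) fun i hi => by interval_cases i; decide +kernel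

def code_21_16 : BlockCode where
  a := 21
  b := 16
  d := 2
  k := 25441
  ℓ := 5606
  depth := 8
  phrases := [
    (0, 0, 0), (1, 19, 1), (5, 19, 0), (10, 14, 0), (21, 15, 1), (11, 9, 1), (36, 35, 0),
    (27, 10, 1), (57, 14, 1), (104, 16, 0), (21, 14, 1), (57, 15, 0), (57, 39, 1), (36, 20, 2),
    (114, 37, 0), (42, 14, 0), (264, 417, 2), (471, 470, 1), (264, 205, 1), (23, 11, 1),
    (149, 19, 0), (1403, 14, 1), (1262, 537, 1), (264, 144, 1), (82, 19, 0), (2136, 3455, 2),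
    (264, 164, 2), (2194, 609, 1), (4251, 3475, 1), (2136, 2126, 1), (42, 19, 1),
    (5618, 5596, 2), (1335, 25, 2), (1366, 25, 2), (192, 25, 2), (104, 168, 1), (26, 17, 0),
    (55, 15, 1), (2294, 682, 0), (166, 10, 0), (3014, 75, 1), (777, 691, 0), (80, 13, 1),
    (1497, 72, 1), (3123, 691, 1), (161, 22, 1), (125, 19, 0), (6750, 3850, 1), (218, 18, 0),
    (4680, 49, 1), (112, 34, 1), (184, 19, 0), (57, 15, 1), (688, 214, 1), (219, 18, 1),
    (2080, 17, 0), (21, 403, 1), (582, 39, 1), (1648, 514, 1), (2356, 25, 1), (1251, 40, 1),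
    (4, 3, 0)]
  periods := [1, 2, 3, 7, 12, 13, 21, 33, 43, 99, 103, 267, 773]

theorem describes_21_16 : Describes 21 16 2 25441 5606 code_21_16.word :=
  describes (C := code_21_16) (by decide +kernel) (by decide +kernel) (by decide +kernel) 2
    (by decide +kernel) fun i hi => by interval_cases i <;> decide +kernel

def code_25_17 : BlockCode where
  a := 25
  b := 17
  d := 1
  k := 11705
  ℓ := 3268
  depth := 8
  phrases := [
    (0, 0, 0), (1, 23, 1), (8, 23, 0), (16, 16, 1), (25, 31, 1), (41, 40, 0), (66, 1543, 1),
    (40, 22, 0), (1690, 128, 1), (12, 15, 1), (499, 323, 1), (25, 23, 0), (25, 599, 1),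
    (2180, 3243, 0), (66, 561, 1), (2250, 1223, 1), (1209, 608, 0), (3469, 1635, 0),
    (2250, 1228, 1), (7433, 80, 1), (10, 15, 1), (431, 289, 1), (24, 13, 0)]
  periods := [1, 2, 6, 14, 25, 37, 41, 66, 78, 136]

theorem describes_25_17 : Describes 25 17 1 11705 3268 code_25_17.word :=
  describes (C := code_25_17) (by decide +kernel) (by decide +kernel) (by decide +kernel) 1
    (by decide +kernel) fun i hi => by interval_cases i; decide +kernel

def code_31_22 : BlockCode where
  a := 31
  b := 22
  d := 1
  k := 1645
  ℓ := 1160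
  depth := 8
  phrases := [
    (0, 0, 0), (1, 29, 1), (9, 26, 0), (18, 21, 1), (31, 35, 1), (49, 48, 0), (80, 1114, 2),
    (400, 359, 1), (4, 3, 0)]
  periods := [1, 2, 40]

theorem describes_31_22 : Describes 31 22 1 1645 1160 code_31_22.word :=
  describes (C := code_31_22) (by decide +kernel) (by decide +kernel) (by decide +kernel) 1
    (by decide +kernel) fun i hi => by interval_cases i; decide +kernel

def code_33_23 : BlockCode where
  a := 33
  b := 23
  d := 1
  k := 24995
  ℓ := 3576
  depth := 8
  phrases := [
    (0, 0, 0), (1, 31, 1), (10, 29, 0), (20, 22, 1), (33, 39, 1), (53, 52, 0), (86, 2701, 1),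
    (50, 26, 0), (2888, 642, 1), (73, 31, 0), (33, 22, 1), (54, 31, 0), (33, 21, 1),
    (109, 3479, 1), (7054, 2794, 0), (53, 40, 1), (6108, 3268, 1), (42, 31, 0), (44, 43, 1),
    (1176, 1047, 1), (7229, 2835, 0), (13610, 3544, 0), (6402, 29, 1), (7796, 564, 1),
    (8100, 1123, 0), (109, 259, 2), (4281, 2256, 1), (9, 7, 0)]
  periods := [1, 2, 26, 27, 62, 86, 108, 109, 134, 294]

theorem describes_33_23 : Describes 33 23 1 24995 3576 code_33_23.word :=
  describes (C := code_33_23) (by decide +kernel) (by decide +kernel) (by decide +kernel) 1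
    (by decide +kernel) fun i hi => by interval_cases i; decide +kernel

def code_37_26 : BlockCode where
  a := 37
  b := 26
  d := 1
  k := 2359
  ℓ := 1680
  depth := 8
  phrases := [
    (0, 0, 0), (1, 35, 1), (11, 32, 0), (22, 25, 1), (37, 43, 1), (59, 58, 0), (96, 1624, 2),
    (576, 527, 1), (10, 5, 0)]
  periods := [1, 2, 48]

theorem describes_37_26 : Describes 37 26 1 2359 1680 code_37_26.word :=
  describes (C := code_37_26) (by decide +kernel) (by decide +kernel) (by decide +kernel) 1
    (by decide +kernel) fun i hi => by interval_cases i; decide +kernel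

def code_37_28 : BlockCode where
  a := 37
  b := 28
  d := 1
  k := 5349
  ℓ := 3861
  depth := 8
  phrases := [
    (0, 0, 0), (1, 35, 1), (9, 35, 0), (18, 26, 0), (37, 27, 1), (19, 17, 1), (64, 63, 0),
    (47, 18, 1), (101, 26, 1), (184, 28, 0), (37, 26, 1), (101, 27, 0), (101, 71, 1),
    (64, 36, 2), (202, 65, 0), (74, 26, 0), (468, 3841, 1), (64, 29, 0), (209, 26, 1),
    (127, 35, 0), (1340, 870, 0)]
  periods := [1, 2, 98, 117]

theorem describes_37_28 : Describes 37 28 1 5349 3861 code_37_28.word :=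
  describes (C := code_37_28) (by decide +kernel) (by decide +kernel) (by decide +kernel) 1
    (by decide +kernel) fun i hi => by interval_cases i; decide +kernel

def code_41_28 : BlockCode where
  a := 41
  b := 28
  d := 1
  k := 2103
  ℓ := 999
  depth := 8
  phrases := [
    (0, 0, 0), (1, 39, 1), (13, 38, 0), (26, 27, 1), (41, 51, 1), (67, 66, 0), (108, 933, 1),
    (27, 39, 0), (68, 627, 1), (721, 38, 0), (1841, 65, 0), (312, 167, 0)]
  periods := [1, 2, 16, 17, 27]

theorem describes_41_28 : Describes 41 28 1 2103 999 code_41_28.word :=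
  describes (C := code_41_28) (by decide +kernel) (by decide +kernel) (by decide +kernel) 1
    (by decide +kernel) fun i hi => by interval_cases i; decide +kernel

def code_49_34 : BlockCode where
  a := 49
  b := 34
  d := 1
  k := 4171
  ℓ := 3008
  depth := 8
  phrases := [
    (0, 0, 0), (1, 47, 1), (15, 44, 0), (30, 33, 1), (49, 59, 1), (79, 78, 0), (128, 2932, 2),
    (1024, 959, 1), (14, 9, 0)]
  periods := [1, 2, 64]

theorem describes_49_34 : Describes 49 34 1 4171 3008 code_49_34.word :=
  describes (C := code_49_34) (by decide +kernel) (by decide +kernel) (by decide +kernel) 1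
    (by decide +kernel) fun i hi => by interval_cases i; decide +kernel

def code_55_38 : BlockCode where
  a := 55
  b := 38
  d := 1
  k := 5269
  ℓ := 3816
  depth := 8
  phrases := [
    (0, 0, 0), (1, 53, 1), (17, 50, 0), (34, 37, 1), (55, 67, 1), (89, 88, 0), (144, 3730, 2),
    (1296, 1223, 1), (16, 11, 0)]
  periods := [1, 2, 72]

theorem describes_55_38 : Describes 55 38 1 5269 3816 code_55_38.word :=
  describes (C := code_55_38) (by decide +kernel) (by decide +kernel) (by decide +kernel) 1
    (by decide +kernel) fun i hi => by interval_cases i; decide +kernel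

def code_53_40 : BlockCode where
  a := 53
  b := 40
  d := 1
  k := 9933
  ℓ := 4149
  depth := 8
  phrases := [
    (0, 0, 0), (1, 51, 1), (13, 51, 0), (26, 38, 0), (53, 39, 1), (27, 25, 1), (92, 91, 0),
    (67, 26, 1), (145, 38, 1), (264, 40, 0), (53, 38, 1), (145, 39, 0), (145, 103, 1),
    (92, 52, 2), (290, 93, 0), (106, 38, 0), (672, 3752, 1), (38, 27, 1), (144, 51, 0),
    (4533, 38, 1), (816, 675, 1), (844, 843, 0), (672, 3749, 1), (12, 11, 0)]
  periods := [1, 2, 3, 54, 84]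

theorem describes_53_40 : Describes 53 40 1 9933 4149 code_53_40.word :=
  describes (C := code_53_40) (by decide +kernel) (by decide +kernel) (by decide +kernel) 1
    (by decide +kernel) fun i hi => by interval_cases i; decide +kernel

def code_59_42 : BlockCode where
  a := 59
  b := 42
  d := 1
  k := 5861
  ℓ := 4332
  depth := 8
  phrases := [
    (0, 0, 0), (1, 57, 1), (17, 50, 0), (34, 41, 1), (59, 67, 1), (93, 92, 0), (152, 4246, 2),
    (1368, 1291, 1), (8, 7, 0)]
  periods := [1, 2, 76]

theorem describes_59_42 : Describes 59 42 1 5861 4332 code_59_42.word :=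
  describes (C := code_59_42) (by decide +kernel) (by decide +kernel) (by decide +kernel) 1
    (by decide +kernel) fun i hi => by interval_cases i; decide +kernel

def code_65_46 : BlockCode where
  a := 65
  b := 46
  d := 1
  k := 7151
  ℓ := 5292
  depth := 8
  phrases := [
    (0, 0, 0), (1, 63, 1), (19, 56, 0), (38, 45, 1), (65, 75, 1), (103, 102, 0), (168, 5196, 2),
    (1680, 1595, 1), (18, 9, 0)]
  periods := [1, 2, 84]

theorem describes_65_46 : Describes 65 46 1 7151 5292 code_65_46.word :=
  describes (C := code_65_46) (by decide +kernel) (by decide +kernel) (by decide +kernel) 1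
    (by decide +kernel) fun i hi => by interval_cases i; decide +kernel

def code_67_46 : BlockCode where
  a := 67
  b := 46
  d := 1
  k := 7849
  ℓ := 5720
  depth := 8
  phrases := [
    (0, 0, 0), (1, 65, 1), (21, 62, 0), (42, 45, 1), (67, 83, 1), (109, 108, 0), (176, 5614, 2),
    (1936, 1847, 1), (20, 15, 0)]
  periods := [1, 2, 88]

theorem describes_67_46 : Describes 67 46 1 7849 5720 code_67_46.word :=
  describes (C := code_67_46) (by decide +kernel) (by decide +kernel) (by decide +kernel) 1
    (by decide +kernel) fun i hi => by interval_cases i; decide +kernel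

def code_71_50 : BlockCode where
  a := 71
  b := 50
  d := 1
  k := 8569
  ℓ := 6348
  depth := 8
  phrases := [
    (0, 0, 0), (1, 69, 1), (21, 62, 0), (42, 49, 1), (71, 83, 1), (113, 112, 0), (184, 6242, 2),
    (2024, 1931, 1), (20, 11, 0)]
  periods := [1, 2, 92]

theorem describes_71_50 : Describes 71 50 1 8569 6348 code_71_50.word :=
  describes (C := code_71_50) (by decide +kernel) (by decide +kernel) (by decide +kernel) 1
    (by decide +kernel) fun i hi => by interval_cases i; decide +kernel

def code_73_50 : BlockCode where
  a := 73
  b := 50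
  d := 1
  k := 9331
  ℓ := 6816
  depth := 8
  phrases := [
    (0, 0, 0), (1, 71, 1), (23, 68, 0), (46, 49, 1), (73, 91, 1), (119, 118, 0), (192, 6700, 2),
    (2304, 2207, 1), (22, 17, 0)]
  periods := [1, 2, 96]

theorem describes_73_50 : Describes 73 50 1 9331 6816 code_73_50.word :=
  describes (C := code_73_50) (by decide +kernel) (by decide +kernel) (by decide +kernel) 1
    (by decide +kernel) fun i hi => by interval_cases i; decide +kernel

def code_77_54 : BlockCode where
  a := 77
  b := 54
  d := 1
  k := 10115
  ℓ := 7500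
  depth := 8
  phrases := [
    (0, 0, 0), (1, 75, 1), (23, 68, 0), (46, 53, 1), (77, 91, 1), (123, 122, 0), (200, 7384, 2),
    (2400, 2299, 1), (22, 13, 0)]
  periods := [1, 2, 100]

theorem describes_77_54 : Describes 77 54 1 10115 7500 code_77_54.word :=
  describes (C := code_77_54) (by decide +kernel) (by decide +kernel) (by decide +kernel) 1
    (by decide +kernel) fun i hi => by interval_cases i; decide +kernel

end BlockCode

/-! ### The table and the explicit words -/

open BlockCode in
theorem exists_describes :
    ∀ t ∈ sporadicTable, ∃ u, Describes t.1 t.2.1 t.2.2.1 t.2.2.2.1 t.2.2.2.2 u := by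
  simp only [sporadicTable, List.forall_mem_cons]
  exact ⟨⟨_, describes_7_4⟩,
    ⟨_, describes_8_5⟩,
    ⟨_, describes_13_9⟩,
    ⟨_, describes_17_10⟩,
    ⟨_, describes_15_11⟩,
    ⟨_, describes_16_13⟩,
    ⟨_, describes_18_13⟩,
    ⟨_, describes_19_13⟩,
    ⟨_, describes_21_16⟩,
    ⟨_, describes_25_17⟩,
    ⟨_, describes_31_22⟩,
    ⟨_, describes_33_23⟩,
    ⟨_, describes_37_26⟩,
    ⟨_, describes_37_28⟩,
    ⟨_, describes_41_28⟩,
    ⟨_, describes_49_34⟩,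
    ⟨_, describes_55_38⟩,
    ⟨_, describes_53_40⟩,
    ⟨_, describes_59_42⟩,
    ⟨_, describes_65_46⟩,
    ⟨_, describes_67_46⟩,
    ⟨_, describes_71_50⟩,
    ⟨_, describes_73_50⟩,
    ⟨_, describes_77_54⟩, nofun⟩

theorem word_code_8_5 : BlockCode.code_8_5.word = word85 := by
  decide +kernel

theorem word74Prefix_isPrefix : word74Prefix <+: BlockCode.code_7_4.word := by
  have h : word74Prefix = wordFactor BlockCode.code_7_4.letter 0 36 := by decide +kernel
  rw [h]
  -- The word has length `k - 1 = 50846 = 36 + 50810`.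
  exact ⟨_, (wordFactor_zero_add _ 36 50810).symm⟩

theorem word74Suffix_isSuffix : word74Suffix <:+ BlockCode.code_7_4.word := by
  have h : word74Suffix = wordFactor BlockCode.code_7_4.letter 50827 19 := by decide +kernel
  rw [h]
  exact ⟨_, (wordFactor_zero_add _ 50827 19).symm⟩

theorem mainTheorem6 :
    (∀ a b d k ℓ : ℕ, (a, b, d, k, ℓ) ∈ sporadicTable → ∃ u : List ℕ, Describes a b d k ℓ u) ∧
    Describes 8 5 2 733 301 word85 ∧
    (∃ u : List ℕ, word74Prefix <+: u ∧ word74Suffix <:+ u ∧ Describes 7 4 2 50847 12940 u) :=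
  ⟨fun _ _ _ _ _ h => exists_describes _ h, word_code_8_5 ▸ BlockCode.describes_8_5,
    _, word74Prefix_isPrefix, word74Suffix_isSuffix, BlockCode.describes_7_4⟩
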